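/- Let $\mu>-\tfrac12$ be real, let $l\ge 0$ be an integer, and write $\|v\|_{\omega}=\bigl(\int_{\mathbb R}|v(x)|^2|x|^{2\mu}\,dx\bigr)^{1/2}$ and $L^2_\omega=L^2(\mathbb R,|x|^{2\mu}dx)$ (complex valued). For $\beta>0$ and an integer $n\ge 0$ let $\widehat\Pi_n^{(\mu,\beta)}$ be the orthogonal projection of $L^2_\omega$ onto the space $\{e^{-\beta^2x^2/2}p(x): p \text{ a polynomial of degree at most } n\}$ (equivalently, the truncation of the expansion in scaled generalized Hermite functions to its first $n+1$ terms). There is a constant $C$ depending only on $\mu$ and $l$ such that the following holds for all $\beta>0$, $A\ge 0$, $u\in L^2_\omega$, all measurable $f$ and all integers $N\ge 1$. Suppose that $$\bigl\|u-\widehat\Pi_n^{(\mu,\beta)}u\bigr\|_{\omega}\le A\Bigl(\int_n^{\infty}|f(x)|^2\,dx\Bigr)^{1/2}\qquad\text{for all integers } n\ge N .$$ Then $$\bigl\|\partial_x^l\bigl(u-\widehat\Pi_N^{(\mu,\beta)}u\bigr)\bigr\|_{\omega}\le C\,A\,\beta^l\Bigl(\int_N^{\infty}|f(x)|^2x^l\,dx\Bigr)^{1/2}.$$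 Here $\partial_x^l$ is the $l$-th weak derivative on $\mathbb R\setminus\{0\}$. Whenever $\int_N^\infty|f(x)|^2x^l\,dx<\infty$, this derivative of $u-\widehat\Pi_N^{(\mu,\beta)}u$ exists as a locally integrable function on $\mathbb R\setminus\{0\}$, and if moreover $\mu<\tfrac12$ it is also the weak derivative on the whole line $\mathbb R$. -/

import Mathlib

open MeasureTheory Set
open scoped ENNReal NNReal

noncomputable section

/-- The measure `|x|^{2μ} dx` on the real line. -/
def weight (μ : ℝ) : Measure ℝ :=
  volume.withDensity fun x => ENNReal.ofReal (|x| ^ (2 * μ))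

/-- The space of (classes of) functions `e^{-β²x²/2} p(x)`, `p` a complex polynomial of degree at
most `N`, inside `L²(|x|^{2μ} dx)`. For `μ > -1/2` and `β ≠ 0` every such function belongs to
`L²(|x|^{2μ} dx)`. -/
def hermiteSpace (μ β : ℝ) (N : ℕ) : Submodule ℂ (Lp ℂ 2 (weight μ)) where
  carrier := {φ | ∃ p ∈ Polynomial.degreeLE ℂ (N : WithBot ℕ),
    φ =ᵐ[weight μ] fun x : ℝ => (Real.exp (-(β ^ 2 * x ^ 2) / 2) : ℂ) * p.eval (x : ℂ)}
  zero_mem' := ⟨0, Submodule.zero_mem _, by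
    filter_upwards [Lp.coeFn_zero ℂ 2 (weight μ)] with x hx
    rw [hx]
    simp⟩
  add_mem' := by
    rintro φ ψ ⟨p, hp, hφ⟩ ⟨q, hq, hψ⟩
    refine ⟨p + q, Submodule.add_mem _ hp hq, ?_⟩
    filter_upwards [Lp.coeFn_add φ ψ, hφ, hψ] with x h₁ h₂ h₃
    rw [h₁, Pi.add_apply, h₂, h₃, Polynomial.eval_add, mul_add]
  smul_mem' := by
    rintro c φ ⟨p, hp, hφ⟩
    refine ⟨c • p, Submodule.smul_mem _ c hp, ?_⟩
    filter_upwards [Lp.coeFn_smul c φ, hφ] with x h₁ h₂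
    rw [h₁, Pi.smul_apply, h₂, Polynomial.eval_smul, smul_eq_mul, smul_eq_mul]
    ring

instance hermiteSpace_finiteDimensional (μ β : ℝ) (N : ℕ) :
    FiniteDimensional ℂ (hermiteSpace μ β N) := by
  let w : Polynomial ℂ → ℝ → ℂ :=
    fun p x => (Real.exp (-(β ^ 2 * x ^ 2) / 2) : ℂ) * p.eval (x : ℂ)
  have hadd : ∀ p q, w (p + q) = w p + w q := by
    intro p q; ext x; simp [w, mul_add]
  have hsmul : ∀ (c : ℂ) p, w (c • p) = c • w p := by
    intro c p; ext x; simp [w]; ring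
  have h0 : w 0 = 0 := by ext x; simp [w]
  let T : Submodule ℂ (Polynomial ℂ) :=
    { carrier := {p | p ∈ Polynomial.degreeLT ℂ (N + 1) ∧ MemLp (w p) 2 (weight μ)}
      zero_mem' := ⟨Submodule.zero_mem _, by rw [h0]; exact MemLp.zero⟩
      add_mem' := fun {p q} hp hq =>
        ⟨Submodule.add_mem _ hp.1 hq.1, by rw [hadd]; exact hp.2.add hq.2⟩
      smul_mem' := fun c p hp =>
        ⟨Submodule.smul_mem _ c hp.1, by rw [hsmul]; exact hp.2.const_smul c⟩ }
  have : FiniteDimensional ℂ (Polynomial.degreeLT ℂ (N + 1)) :=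
    (Polynomial.degreeLTEquiv ℂ (N + 1)).symm.finiteDimensional
  have : FiniteDimensional ℂ T :=
    Submodule.finiteDimensional_of_le (S₂ := Polynomial.degreeLT ℂ (N + 1)) fun p hp => hp.1
  let L : T →ₗ[ℂ] Lp ℂ 2 (weight μ) :=
    { toFun := fun p => p.2.2.toLp (w p)
      map_add' := fun p q => by
        rw [← MemLp.toLp_add]
        exact MemLp.toLp_congr _ _ (by rw [Submodule.coe_add, hadd])
      map_smul' := fun c p => by
        rw [RingHom.id_apply, ← MemLp.toLp_const_smul]
        exact MemLp.toLp_congr _ _ (by rw [Submodule.coe_smul, hsmul]) }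
  refine Submodule.finiteDimensional_of_le (S₂ := LinearMap.range L) ?_
  rintro φ ⟨p, hp, hφ⟩
  have hm : MemLp (w p) 2 (weight μ) := (memLp_congr_ae hφ).1 (Lp.memLp φ)
  have hp' : p ∈ Polynomial.degreeLT ℂ (N + 1) :=
    Polynomial.mem_degreeLT.2 (lt_of_le_of_lt (Polynomial.mem_degreeLE.1 hp)
      (by exact_mod_cast Nat.lt_succ_self N))
  refine ⟨⟨p, hp', hm⟩, ?_⟩
  exact Lp.ext (hm.coeFn_toLp.trans hφ.symm)

/-- The scaled generalized Hermite projection: the orthogonal projection of `L²(|x|^{2μ} dx)`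
onto `hermiteSpace μ β N`. -/
def hermiteProj (μ β : ℝ) (N : ℕ) (u : Lp ℂ 2 (weight μ)) : Lp ℂ 2 (weight μ) :=
  (hermiteSpace μ β N).starProjection u

/-- `g` is the `l`-th weak (distributional) derivative of `v` on the open set `Ω`. -/
def HasWeakDeriv (Ω : Set ℝ) (l : ℕ) (v g : ℝ → ℂ) : Prop :=
  LocallyIntegrableOn v Ω ∧ LocallyIntegrableOn g Ω ∧
    ∀ φ : ℝ → ℂ, ContDiff ℝ (⊤ : ℕ∞) φ → HasCompactSupport φ → tsupport φ ⊆ Ω →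
      ∫ x, v x * iteratedDeriv l φ x = (-1) ^ l * ∫ x, g x * φ x

end

/-!
Write elements of `hermiteSpace` as `e^{-b x²/2} p` with `b = β²`. On polynomials the Dunkl operator
`T` lowers and its adjoint `2 b X - T` raises the level in the orthogonal decomposition by degree,
with norms of order `(b n)^{1/2}` at level `n`. Half their difference is the Dunkl operator
conjugated by the Gaussian, so the squared norm of its `l`-th power at `u = ∑ uₙ` is bounded by a
constant times `b^l ∑ (n + 1)^l ‖uₙ‖²`. The ordinary derivative differs from that conjugate by a
multiple of the odd difference quotient, and a Hardy inequality,
valid for `μ > -1/2`, bounds that quotient by the Dunkl derivative. Finally, summation by parts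
turns the decay of the tails `∑_{k > n} ‖uₖ‖² = ‖u - Πₙ u‖²` into a bound of
`∑ (n + 1)^l ‖uₙ‖²` by the integral with the weight `x^l`, and closedness of the weak derivative
passes to the limit.
-/

noncomputable section

section DunklOperators

open Polynomial

variable {R : Type*} [CommRing R]

/-- The reflection `p(X) ↦ p(-X)`. -/
def reflection : R[X] →ₐ[R] R[X] := aeval (-X)

theorem reflection_eq_comp (p : R[X]) : reflection p = p.comp (-X) := rfl

theorem reflection_reflection (p : R[X]) : reflection (reflection p) = p := by
  simp [reflection_eq_comp, comp_assoc]

theorem reflection_X_mul (p : R[X]) : reflection (X * p) = -(X * reflection p) := by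
  simp [reflection_eq_comp]

theorem reflection_X_pow (n : ℕ) : reflection (X ^ n : R[X]) = (-1 : R) ^ n • X ^ n := by
  simp [reflection, neg_pow (X : R[X]), smul_eq_C_mul]

theorem reflection_derivative (p : R[X]) :
    reflection (derivative p) = -derivative (reflection p) := by
  simp [reflection_eq_comp, derivative_comp]

theorem coeff_reflection (p : R[X]) (n : ℕ) :
    (reflection p).coeff n = (-1) ^ n * p.coeff n := by
  rw [reflection_eq_comp, ← neg_one_mul, ← C_1, ← C_neg, comp_C_mul_X_coeff, mul_comm]

/-- The difference quotient `p(X) ↦ (p(X) - p(-X)) / X`. -/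
def oddQuotient : R[X] →ₗ[R] R[X] where
  toFun p := divX (p - reflection p)
  map_add' p q := by rw [map_add, add_sub_add_comm, divX_add]
  map_smul' c p := by
    rw [map_smul, ← smul_sub, smul_eq_C_mul, divX_C_mul, smul_eq_C_mul, RingHom.id_apply]

theorem coeff_oddQuotient (p : R[X]) (n : ℕ) :
    (oddQuotient p).coeff n = (1 - (-1) ^ (n + 1)) * p.coeff (n + 1) := by
  rw [oddQuotient, LinearMap.coe_mk, AddHom.coe_mk, coeff_divX, coeff_sub, coeff_reflection]
  ring

theorem X_mul_oddQuotient (p : R[X]) : X * oddQuotient p = p - reflection p := by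
  ext n
  cases n <;> simp [coeff_oddQuotient, coeff_reflection, sub_mul]

theorem oddQuotient_reflection (p : R[X]) : oddQuotient (reflection p) = -oddQuotient p :=
  isRegular_X.left <| by
    simp only [mul_neg, X_mul_oddQuotient, reflection_reflection, neg_sub]

theorem reflection_oddQuotient (p : R[X]) : reflection (oddQuotient p) = oddQuotient p :=
  isRegular_X.left <| by
    simp only
    rw [← neg_inj, ← reflection_X_mul, X_mul_oddQuotient, map_sub, reflection_reflection, neg_sub]

theorem oddQuotient_X_mul (p : R[X]) : oddQuotient (X * p) = p + reflection p :=
  isRegular_X.left <| by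
    simp only [X_mul_oddQuotient, reflection_X_mul]
    ring

/-- The Dunkl operator `p ↦ p' + κ (p(X) - p(-X)) / X`. -/
def dunkl (κ : R) : R[X] →ₗ[R] R[X] := derivative + κ • oddQuotient

theorem dunkl_apply (κ : R) (p : R[X]) : dunkl κ p = derivative p + κ • oddQuotient p := rfl

/-- The factor by which the Dunkl operator sends `X ^ n` to `X ^ (n - 1)`. -/
def dunklCoeff (κ : R) (n : ℕ) : R := n + κ * (1 - (-1) ^ n)

theorem coeff_dunkl (κ : R) (p : R[X]) (n : ℕ) :
    (dunkl κ p).coeff n = dunklCoeff κ (n + 1) * p.coeff (n + 1) := by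
  simp only [dunkl_apply, coeff_add, coeff_derivative, coeff_smul, coeff_oddQuotient, smul_eq_mul,
    dunklCoeff]
  push_cast
  ring

theorem dunkl_X_pow (κ : R) (n : ℕ) :
    dunkl κ (X ^ n) = dunklCoeff κ n • (X ^ (n - 1) : R[X]) := by
  ext k
  rw [coeff_dunkl, coeff_smul, coeff_X_pow, coeff_X_pow, smul_eq_mul]
  rcases n with _ | n <;> simp +contextual [dunklCoeff]

theorem dunkl_X_mul (κ : R) (p : R[X]) :
    dunkl κ (X * p) = X * dunkl κ p + p + (2 * κ) • reflection p := by
  have h : oddQuotient (X * p) = X * oddQuotient p + (2 : R) • reflection p := by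
    rw [oddQuotient_X_mul, X_mul_oddQuotient]
    module
  rw [dunkl_apply, dunkl_apply, h, derivative_mul, derivative_X, one_mul, mul_add,
    mul_smul_comm]
  module

/-- The raising operator `p ↦ 2 b X p - T p`, where `T` is the Dunkl operator `dunkl κ`: it is the
formal adjoint of `T` for the weight `|x| ^ (2κ) e^{-b x²}`. -/
def dunklAdjoint (κ b : R) : R[X] →ₗ[R] R[X] := (2 * b) • LinearMap.mulLeft R X - dunkl κ

theorem dunklAdjoint_apply (κ b : R) (p : R[X]) :
    dunklAdjoint κ b p = (2 * b) • (X * p) - dunkl κ p := rfl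

theorem dunkl_dunklAdjoint (κ b : R) (p : R[X]) :
    dunkl κ (dunklAdjoint κ b p) =
      dunklAdjoint κ b (dunkl κ p) + (2 * b) • (p + (2 * κ) • reflection p) := by
  simp only [dunklAdjoint_apply, map_sub, map_smul, dunkl_X_mul]
  module

/-- The operator `D` on polynomials with `(e^{-b x²/2} p)' = e^{-b x²/2} D p`. -/
def gaussDeriv (b : R) : R[X] →ₗ[R] R[X] := derivative - b • LinearMap.mulLeft R X

theorem gaussDeriv_apply (b : R) (p : R[X]) :
    gaussDeriv b p = derivative p - b • (X * p) := rfl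

theorem reflection_gaussDeriv (b : R) (p : R[X]) :
    reflection (gaussDeriv b p) = -gaussDeriv b (reflection p) := by
  simp only [gaussDeriv_apply, map_sub, map_smul, reflection_X_mul, reflection_derivative]
  module

theorem reflection_gaussDeriv_pow (b : R) (k : ℕ) (p : R[X]) :
    reflection ((gaussDeriv b ^ k) p) = (-1 : R) ^ k • (gaussDeriv b ^ k) (reflection p) := by
  induction k generalizing p with
  | zero => simp
  | succ k ih =>
    rw [pow_succ, Module.End.mul_apply, ih, reflection_gaussDeriv, map_neg, Module.End.mul_apply,
      pow_succ]
    module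

theorem gaussDeriv_X_mul (b : R) (p : R[X]) :
    gaussDeriv b (X * p) = X * gaussDeriv b p + p := by
  simp only [gaussDeriv_apply, derivative_mul, derivative_X, mul_sub, mul_smul_comm]
  ring

theorem gaussDeriv_pow_X_mul (b : R) (k : ℕ) (p : R[X]) :
    (gaussDeriv b ^ (k + 1)) (X * p) =
      X * (gaussDeriv b ^ (k + 1)) p + (k + 1 : R) • (gaussDeriv b ^ k) p := by
  induction k generalizing p with
  | zero => simp [gaussDeriv_X_mul]
  | succ k ih =>
    rw [pow_succ _ (k + 1), Module.End.mul_apply, gaussDeriv_X_mul, map_add, ih,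
      Module.End.mul_apply, ← Module.End.mul_apply (gaussDeriv b ^ k), ← pow_succ]
    push_cast
    module

/-- The operator on polynomials given by conjugating the Dunkl operator with `e^{-b x²/2}`. -/
def gaussDunkl (κ b : R) : R[X] →ₗ[R] R[X] := gaussDeriv b + κ • oddQuotient

theorem gaussDunkl_apply (κ b : R) (p : R[X]) :
    gaussDunkl κ b p = gaussDeriv b p + κ • oddQuotient p := rfl

theorem reflection_gaussDunkl (κ b : R) (p : R[X]) :
    reflection (gaussDunkl κ b p) = -gaussDunkl κ b (reflection p) := by
  simp only [gaussDunkl_apply, map_add, map_smul, reflection_gaussDeriv, reflection_oddQuotient,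
    oddQuotient_reflection]
  module

theorem two_smul_gaussDunkl (κ b : R) (p : R[X]) :
    (2 : R) • gaussDunkl κ b p = dunkl κ p - dunklAdjoint κ b p := by
  rw [gaussDunkl_apply, gaussDeriv_apply, dunklAdjoint_apply, dunkl_apply]
  module

theorem gaussDeriv_pow_gaussDunkl_X_mul_oddQuotient (κ b : R) (k : ℕ) (p : R[X]) :
    (gaussDeriv b ^ k) (gaussDunkl κ b (X * oddQuotient p)) =
      X * gaussDeriv b ((gaussDeriv b ^ k) (oddQuotient p)) +
        (k + 1 + 2 * κ) • (gaussDeriv b ^ k) (oddQuotient p) := by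
  have h : oddQuotient (X * oddQuotient p) = (2 : R) • oddQuotient p := by
    rw [oddQuotient_X_mul, reflection_oddQuotient, two_smul]
  rw [gaussDunkl_apply, h, map_add, map_smul, map_smul, ← Module.End.mul_apply, ← pow_succ,
    gaussDeriv_pow_X_mul, pow_succ', Module.End.mul_apply]
  module

theorem dunkl_mem_degreeLT (κ : R) {n : ℕ} {p : R[X]} (hp : p ∈ degreeLT R (n + 1)) :
    dunkl κ p ∈ degreeLT R n := by
  rw [mem_degreeLT, degree_lt_iff_coeff_zero] at hp ⊢
  intro k hk
  rw [coeff_dunkl, hp _ (by lia), mul_zero]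

theorem X_mul_mem_degreeLT {n : ℕ} {p : R[X]} (hp : p ∈ degreeLT R n) :
    X * p ∈ degreeLT R (n + 1) := by
  rw [mem_degreeLT, degree_lt_iff_coeff_zero] at hp ⊢
  rintro (_ | k) hk
  · lia
  · rw [coeff_X_mul, hp k (by lia)]

theorem dunklAdjoint_mem_degreeLT (κ b : R) {n : ℕ} {p : R[X]} (hp : p ∈ degreeLT R n) :
    dunklAdjoint κ b p ∈ degreeLT R (n + 1) :=
  sub_mem (Submodule.smul_mem _ _ (X_mul_mem_degreeLT hp))
    (degreeLT_mono (by lia) (dunkl_mem_degreeLT κ (degreeLT_mono n.le_succ hp)))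

end DunklOperators

section HermiteEmbedding

open Polynomial

variable {𝕜 E : Type*} [RCLike 𝕜] [NormedAddCommGroup E] [InnerProductSpace 𝕜 E]

theorem inner_eq_of_forall_X_pow {f₁ g₁ f₂ g₂ : 𝕜[X] →ₗ[𝕜] E}
    (h : ∀ i j : ℕ, inner 𝕜 (f₁ (X ^ i)) (g₁ (X ^ j)) = inner 𝕜 (f₂ (X ^ i)) (g₂ (X ^ j)))
    (p q : 𝕜[X]) : inner 𝕜 (f₁ p) (g₁ q) = inner 𝕜 (f₂ p) (g₂ q) := by
  have hmon (n : ℕ) (z : 𝕜) : monomial n z = z • (X ^ n : 𝕜[X]) := by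
    rw [← monomial_one_right_eq_X_pow, smul_monomial, smul_eq_mul, mul_one]
  induction p using Polynomial.induction_on' with
  | add p p' hp hp' => rw [map_add, map_add, inner_add_left, inner_add_left, hp, hp']
  | monomial i c =>
    induction q using Polynomial.induction_on' with
    | add q q' hq hq' => rw [map_add, map_add, inner_add_right, inner_add_right, hq, hq']
    | monomial j c' => simp only [hmon, map_smul, inner_smul_left, inner_smul_right, h i j]

/-- A linear map `J` from polynomials to an inner product space realizing the inner product of
`L²(|x|^{2μ} e^{-b x²} dx)`. The measure enters only through the parity and the recurrence of its
moments `m`, which is all that the calculus of ladder operators depends on. -/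
structure IsHermiteEmbedding (μ b : ℝ) (m : ℕ → ℝ) (J : 𝕜[X] →ₗ[𝕜] E) : Prop where
  inner_X_pow : ∀ i j : ℕ, inner 𝕜 (J (X ^ i)) (J (X ^ j)) = (m (i + j) : 𝕜)
  moment_of_odd : ∀ k, Odd k → m k = 0
  moment_add_two : ∀ k : ℕ, 2 * b * m (k + 2) = (k + 1 + 2 * μ) * m k

/-- `p` has degree at most `n` and `J p` is orthogonal to the images of lower degree, as for a
multiple of the `n`-th generalized Hermite polynomial. -/
def IsHermiteLevel (J : 𝕜[X] →ₗ[𝕜] E) (n : ℕ) (p : 𝕜[X]) : Prop :=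
  p ∈ degreeLT 𝕜 (n + 1) ∧ ∀ q ∈ degreeLT 𝕜 n, inner 𝕜 (J q) (J p) = 0

namespace IsHermiteLevel

variable {J : 𝕜[X] →ₗ[𝕜] E}

theorem zero (J : 𝕜[X] →ₗ[𝕜] E) (n : ℕ) : IsHermiteLevel J n 0 :=
  ⟨Submodule.zero_mem _, fun q _ => by simp⟩

theorem dunkl_eq_zero (κ : 𝕜) {p : 𝕜[X]} (hp : IsHermiteLevel J 0 p) : dunkl κ p = 0 := by
  have h := dunkl_mem_degreeLT κ hp.1
  rwa [mem_degreeLT, Nat.cast_zero, Nat.WithBot.lt_zero_iff, degree_eq_bot] at h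

theorem inner_eq_zero {i j : ℕ} {p q : 𝕜[X]} (hp : IsHermiteLevel J i p)
    (hq : IsHermiteLevel J j q) (hij : i < j) : inner 𝕜 (J p) (J q) = 0 :=
  hq.2 p (degreeLT_mono hij hp.1)

end IsHermiteLevel

theorem norm_sum_sq_of_isHermiteLevel {J : 𝕜[X] →ₗ[𝕜] E} {p : ℕ → 𝕜[X]}
    (hp : ∀ n, IsHermiteLevel J n (p n)) (s : Finset ℕ) :
    ‖J (∑ n ∈ s, p n)‖ ^ 2 = ∑ n ∈ s, ‖J (p n)‖ ^ 2 := by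
  induction s using Finset.induction_on_max with
  | empty => simp
  | insert n s hn ih =>
    have hns : n ∉ s := fun h => (hn n h).false
    have h : inner 𝕜 (J (p n)) (J (∑ k ∈ s, p k)) = 0 := by
      rw [map_sum, inner_sum, Finset.sum_eq_zero]
      exact fun k hk => inner_eq_zero_symm.1 ((hp k).inner_eq_zero (hp n) (hn k hk))
    rw [Finset.sum_insert hns, Finset.sum_insert hns, map_add, ← ih, sq, sq, sq,
      norm_add_sq_eq_norm_sq_add_norm_sq_of_inner_eq_zero _ _ h]

theorem norm_sub_sq_le (v w : E) : ‖v - w‖ ^ 2 ≤ 2 * (‖v‖ ^ 2 + ‖w‖ ^ 2) :=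
  (pow_le_pow_left₀ (norm_nonneg _) (norm_sub_le v w) 2).trans add_sq_le

namespace IsHermiteEmbedding

variable {μ b : ℝ} {m : ℕ → ℝ} {J : 𝕜[X] →ₗ[𝕜] E} (hJ : IsHermiteEmbedding μ b m J)

include hJ

theorem inner_X_mul (p q : 𝕜[X]) : inner 𝕜 (J (X * p)) (J q) = inner 𝕜 (J p) (J (X * q)) := by
  refine inner_eq_of_forall_X_pow (f₁ := J ∘ₗ LinearMap.mulLeft 𝕜 X) (f₂ := J) (g₁ := J)
    (g₂ := J ∘ₗ LinearMap.mulLeft 𝕜 X) (fun i j => ?_) p q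
  simp only [LinearMap.comp_apply, LinearMap.mulLeft_apply, ← pow_succ', hJ.inner_X_pow]
  rw [add_right_comm, add_assoc]

theorem inner_reflection (p q : 𝕜[X]) :
    inner 𝕜 (J (reflection p)) (J q) = inner 𝕜 (J p) (J (reflection q)) := by
  refine inner_eq_of_forall_X_pow (f₁ := J ∘ₗ reflection.toLinearMap) (f₂ := J) (g₁ := J)
    (g₂ := J ∘ₗ reflection.toLinearMap) (fun i j => ?_) p q
  simp only [LinearMap.comp_apply, AlgHom.toLinearMap_apply, reflection_X_pow, map_smul]
  simp only [inner_smul_left, inner_smul_right, hJ.inner_X_pow, map_pow, map_neg, map_one]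
  rcases Nat.even_or_odd (i + j) with hij | hij
  · rw [neg_one_pow_congr (Nat.even_add.1 hij)]
  · rw [hJ.moment_of_odd _ hij, RCLike.ofReal_zero, mul_zero, mul_zero]

theorem norm_reflection (p : 𝕜[X]) : ‖J (reflection p)‖ = ‖J p‖ := by
  rw [@norm_eq_sqrt_re_inner 𝕜, hJ.inner_reflection, reflection_reflection,
    ← @norm_eq_sqrt_re_inner 𝕜]

theorem dunklCoeff_mul_moment_add (i j : ℕ) :
    dunklCoeff μ i * m (i - 1 + j) + dunklCoeff μ j * m (i + (j - 1)) =
      2 * b * m (i + j + 1) := by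
  have h0 : dunklCoeff μ 0 = 0 := by simp [dunklCoeff]
  rcases hk : i + j with _ | k
  · obtain ⟨rfl, rfl⟩ := Nat.add_eq_zero_iff.1 hk
    simp [h0, hJ.moment_of_odd 1 odd_one]
  have hi : dunklCoeff μ i * m (i - 1 + j) = dunklCoeff μ i * m k := by
    rcases i with _ | i
    · simp [h0]
    · congr 2; lia
  have hj : dunklCoeff μ j * m (i + (j - 1)) = dunklCoeff μ j * m k := by
    rcases j with _ | j
    · simp [h0]
    · congr 2; lia
  have hpar : ((-1) ^ i + (-1) ^ j) * m k = 0 := by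
    rcases Nat.even_or_odd k with hke | hko
    · have hij : Even i ↔ Even (j + 1) := by grind
      rw [neg_one_pow_congr hij, pow_succ]
      ring
    · rw [hJ.moment_of_odd k hko, mul_zero]
  have hcast : (i + j : ℝ) = k + 1 := by exact_mod_cast hk
  rw [hi, hj, hJ.moment_add_two, dunklCoeff, dunklCoeff]
  linear_combination m k * hcast - μ * hpar

theorem inner_dunkl (p q : 𝕜[X]) :
    inner 𝕜 (J (dunkl (μ : 𝕜) p)) (J q) = inner 𝕜 (J p) (J (dunklAdjoint (μ : 𝕜) b q)) := by
  refine inner_eq_of_forall_X_pow (f₁ := J ∘ₗ dunkl (μ : 𝕜)) (f₂ := J) (g₁ := J)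
    (g₂ := J ∘ₗ dunklAdjoint (μ : 𝕜) b) (fun i j => ?_) p q
  have hcoeff (n : ℕ) : dunklCoeff (μ : 𝕜) n = (dunklCoeff μ n : ℝ) := by
    simp [dunklCoeff]
  have h := congrArg (RCLike.ofReal (K := 𝕜)) (hJ.dunklCoeff_mul_moment_add i j)
  push_cast at h
  simp only [LinearMap.comp_apply, dunklAdjoint_apply, dunkl_X_pow, ← pow_succ', map_smul, map_sub,
    inner_smul_left, inner_smul_right, inner_sub_right, hJ.inner_X_pow, hcoeff, RCLike.conj_ofReal,
    ← add_assoc]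
  linear_combination h

theorem inner_dunklAdjoint (p q : 𝕜[X]) :
    inner 𝕜 (J (dunklAdjoint (μ : 𝕜) b p)) (J q) = inner 𝕜 (J p) (J (dunkl (μ : 𝕜) q)) := by
  rw [← inner_conj_symm, ← hJ.inner_dunkl, inner_conj_symm]

theorem isHermiteLevel_dunkl {n : ℕ} {p : 𝕜[X]} (hp : IsHermiteLevel J (n + 1) p) :
    IsHermiteLevel J n (dunkl (μ : 𝕜) p) := by
  refine ⟨dunkl_mem_degreeLT _ hp.1, fun q hq => ?_⟩
  rw [← hJ.inner_dunklAdjoint]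
  exact hp.2 _ (dunklAdjoint_mem_degreeLT _ _ hq)

theorem isHermiteLevel_dunklAdjoint {n : ℕ} {p : 𝕜[X]} (hp : IsHermiteLevel J n p) :
    IsHermiteLevel J (n + 1) (dunklAdjoint (μ : 𝕜) b p) := by
  refine ⟨dunklAdjoint_mem_degreeLT _ _ hp.1, fun q hq => ?_⟩
  rw [← hJ.inner_dunkl]
  exact hp.2 _ (dunkl_mem_degreeLT _ hq)

theorem norm_dunklAdjoint_sq (p : 𝕜[X]) :
    ‖J (dunklAdjoint (μ : 𝕜) b p)‖ ^ 2 = ‖J (dunkl (μ : 𝕜) p)‖ ^ 2 +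
      2 * b * (‖J p‖ ^ 2 + 2 * μ * RCLike.re (inner 𝕜 (J p) (J (reflection p)))) := by
  have h : inner 𝕜 (J (dunklAdjoint (μ : 𝕜) b p)) (J (dunklAdjoint (μ : 𝕜) b p)) =
      inner 𝕜 (J (dunkl (μ : 𝕜) p)) (J (dunkl (μ : 𝕜) p)) + ((2 * b : ℝ) : 𝕜) *
        (inner 𝕜 (J p) (J p) + ((2 * μ : ℝ) : 𝕜) * inner 𝕜 (J p) (J (reflection p))) := by
    rw [hJ.inner_dunklAdjoint, dunkl_dunklAdjoint, map_add, inner_add_right, ← hJ.inner_dunkl]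
    simp only [map_smul, map_add, inner_smul_right, inner_add_right]
    push_cast
    rfl
  simpa only [map_add, RCLike.re_ofReal_mul, inner_self_eq_norm_sq] using congrArg RCLike.re h

theorem norm_dunklAdjoint_sq_le (hb : 0 ≤ b) (p : 𝕜[X]) :
    ‖J (dunklAdjoint (μ : 𝕜) b p)‖ ^ 2 ≤
      ‖J (dunkl (μ : 𝕜) p)‖ ^ 2 + 2 * b * (1 + 2 * |μ|) * ‖J p‖ ^ 2 := by
  have hre : |RCLike.re (inner 𝕜 (J p) (J (reflection p)))| ≤ ‖J p‖ ^ 2 := by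
    simpa only [hJ.norm_reflection, ← sq] using
      (RCLike.abs_re_le_norm _).trans (norm_inner_le_norm (𝕜 := 𝕜) (J p) (J (reflection p)))
  have hμ : μ * RCLike.re (inner 𝕜 (J p) (J (reflection p))) ≤ |μ| * ‖J p‖ ^ 2 :=
    calc _ ≤ |μ| * |RCLike.re (inner 𝕜 (J p) (J (reflection p)))| :=
          (le_abs_self _).trans (abs_mul _ _).le
      _ ≤ _ := by gcongr
  rw [hJ.norm_dunklAdjoint_sq, mul_assoc (2 * b)]
  gcongr
  linarith

/-- The raising bound at level `n` gives the lowering bound at level `n + 1`, since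
`‖T p‖² = ⟨p, T* T p⟩` and `T p` has level `n`. -/
theorem norm_dunkl_sq_le_of_dunklAdjoint {n : ℕ} {c : ℝ} (hc : 0 ≤ c)
    (h : ∀ q, IsHermiteLevel J n q → ‖J (dunklAdjoint (μ : 𝕜) b q)‖ ^ 2 ≤ c * ‖J q‖ ^ 2)
    {p : 𝕜[X]} (hp : IsHermiteLevel J (n + 1) p) :
    ‖J (dunkl (μ : 𝕜) p)‖ ^ 2 ≤ c * ‖J p‖ ^ 2 := by
  set x := ‖J (dunkl (μ : 𝕜) p)‖ with hxdef
  set y := ‖J (dunklAdjoint (μ : 𝕜) b (dunkl (μ : 𝕜) p))‖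
  have hy : y ^ 2 ≤ c * x ^ 2 := h _ (hJ.isHermiteLevel_dunkl hp)
  have hx : x ^ 2 ≤ ‖J p‖ * y := by
    rw [← inner_self_eq_norm_sq (𝕜 := 𝕜), hJ.inner_dunkl]
    exact re_inner_le_norm _ _
  rcases (norm_nonneg (J (dunkl (μ : 𝕜) p))).eq_or_lt with hx0 | hx0
  · rw [hxdef, ← hx0, zero_pow two_ne_zero]
    positivity
  · refine le_of_mul_le_mul_right ?_ (pow_pos hx0 2)
    calc x ^ 2 * x ^ 2 ≤ (‖J p‖ * y) * (‖J p‖ * y) := by gcongr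
      _ = ‖J p‖ ^ 2 * y ^ 2 := by ring
      _ ≤ ‖J p‖ ^ 2 * (c * x ^ 2) := by gcongr
      _ = c * ‖J p‖ ^ 2 * x ^ 2 := by ring

theorem norm_dunklAdjoint_sq_le_of_isHermiteLevel (hb : 0 ≤ b) {n : ℕ} {p : 𝕜[X]}
    (hp : IsHermiteLevel J n p) :
    ‖J (dunklAdjoint (μ : 𝕜) b p)‖ ^ 2 ≤ (n + 1) * (2 * b * (1 + 2 * |μ|)) * ‖J p‖ ^ 2 := by
  have h := hJ.norm_dunklAdjoint_sq_le hb p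
  induction n generalizing p with
  | zero => simpa [hp.dunkl_eq_zero] using h
  | succ n ih =>
    have hlower := hJ.norm_dunkl_sq_le_of_dunklAdjoint (by positivity)
      (fun q hq => ih hq (hJ.norm_dunklAdjoint_sq_le hb q)) hp
    push_cast
    linarith

theorem norm_dunkl_sq_le_of_isHermiteLevel (hb : 0 ≤ b) {n : ℕ} {p : 𝕜[X]}
    (hp : IsHermiteLevel J (n + 1) p) :
    ‖J (dunkl (μ : 𝕜) p)‖ ^ 2 ≤ (n + 1) * (2 * b * (1 + 2 * |μ|)) * ‖J p‖ ^ 2 :=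
  hJ.norm_dunkl_sq_le_of_dunklAdjoint (by positivity)
    (fun _ hq => hJ.norm_dunklAdjoint_sq_le_of_isHermiteLevel hb hq) hp

end IsHermiteEmbedding

/-- `p` is a finite sum of polynomials `q n` of level `n` with `∑ (n + 1) ^ l ‖J (q n)‖² ≤ c`: a
bound on the spectral Sobolev norm of order `l` of `J p`. -/
def HasSobolevBound (J : 𝕜[X] →ₗ[𝕜] E) (l : ℕ) (p : 𝕜[X]) (c : ℝ) : Prop :=
  ∃ (s : Finset ℕ) (q : ℕ → 𝕜[X]), (∀ n, IsHermiteLevel J n (q n)) ∧ p = ∑ n ∈ s, q n ∧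
    ∑ n ∈ s, (n + 1) ^ l * ‖J (q n)‖ ^ 2 ≤ c

theorem HasSobolevBound.norm_sq_le {J : 𝕜[X] →ₗ[𝕜] E} {p : 𝕜[X]} {c : ℝ}
    (h : HasSobolevBound J 0 p c) : ‖J p‖ ^ 2 ≤ c := by
  obtain ⟨s, q, hq, rfl, hc⟩ := h
  rw [norm_sum_sq_of_isHermiteLevel hq]
  simpa only [pow_zero, one_mul] using hc

/-- The constant in the bound of the powers of the Dunkl operator by spectral Sobolev norms; one
factor arises in each step, from the lowering and the raising part. -/
def dunklConst (μ : ℝ) (l : ℕ) : ℝ := ∏ j ∈ Finset.range l, (1 + 2 * |μ|) * (1 + 2 ^ j)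

theorem dunklConst_pos (μ : ℝ) (l : ℕ) : 0 < dunklConst μ l :=
  Finset.prod_pos fun _ _ => by positivity

/-- The constant in the bound of the `l`-th derivative by the spectral Sobolev norm of order
`l`. -/
def derivConst (μ : ℝ) (l : ℕ) : ℝ :=
  ((1 + 2 * |μ| / (μ + 1 / 2)) ^ l) ^ 2 * dunklConst μ l

theorem derivConst_pos {μ : ℝ} (hμ : -(1 / 2) < μ) (l : ℕ) : 0 < derivConst μ l := by
  have hμ' : 0 < μ + 1 / 2 := by linarith
  exact mul_pos (by positivity) (dunklConst_pos μ l)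

namespace IsHermiteEmbedding

variable {μ b : ℝ} {m : ℕ → ℝ} {J : 𝕜[X] →ₗ[𝕜] E} (hJ : IsHermiteEmbedding μ b m J)

include hJ

theorem hasSobolevBound_dunkl (hb : 0 ≤ b) {l : ℕ} {p : 𝕜[X]} {c : ℝ}
    (h : HasSobolevBound J (l + 1) p c) :
    HasSobolevBound J l (dunkl (μ : 𝕜) p) (2 * b * (1 + 2 * |μ|) * c) := by
  classical
  obtain ⟨s, q, hq, rfl, hc⟩ := h
  have hinj : Set.InjOn Nat.succ (Nat.succ ⁻¹' s) := Nat.succ_injective.injOn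
  refine ⟨s.preimage Nat.succ hinj, fun n => dunkl (μ : 𝕜) (q (n + 1)),
    fun n => hJ.isHermiteLevel_dunkl (hq (n + 1)), ?_, ?_⟩
  · rw [map_sum]
    refine (Finset.sum_preimage Nat.succ s hinj (fun n => dunkl (μ : 𝕜) (q n)) ?_).symm
    rintro (_ | n) - hn
    · exact (hq 0).dunkl_eq_zero _
    · exact absurd (mem_range_self n) hn
  · calc ∑ n ∈ s.preimage Nat.succ hinj, ((n : ℝ) + 1) ^ l * ‖J (dunkl (μ : 𝕜) (q (n + 1)))‖ ^ 2
      _ ≤ ∑ n ∈ s.preimage Nat.succ hinj,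
          2 * b * (1 + 2 * |μ|) * (((n.succ : ℕ) + 1) ^ (l + 1) * ‖J (q n.succ)‖ ^ 2) := by
        refine Finset.sum_le_sum fun n _ => ?_
        calc ((n : ℝ) + 1) ^ l * ‖J (dunkl (μ : 𝕜) (q (n + 1)))‖ ^ 2
          _ ≤ (n + 1) ^ l * ((n + 1) * (2 * b * (1 + 2 * |μ|)) * ‖J (q (n + 1))‖ ^ 2) := by
            gcongr
            exact hJ.norm_dunkl_sq_le_of_isHermiteLevel hb (hq (n + 1))
          _ = 2 * b * (1 + 2 * |μ|) * ((n + 1) ^ (l + 1) * ‖J (q (n + 1))‖ ^ 2) := by ring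
          _ ≤ _ := by
            gcongr
            simp
      _ ≤ 2 * b * (1 + 2 * |μ|) * ∑ n ∈ s, ((n : ℝ) + 1) ^ (l + 1) * ‖J (q n)‖ ^ 2 := by
        rw [← Finset.mul_sum, Finset.sum_preimage' Nat.succ s hinj
          fun n : ℕ => ((n : ℝ) + 1) ^ (l + 1) * ‖J (q n)‖ ^ 2]
        have hss : ∑ n ∈ s with n ∈ range Nat.succ, ((n : ℝ) + 1) ^ (l + 1) * ‖J (q n)‖ ^ 2 ≤
            ∑ n ∈ s, ((n : ℝ) + 1) ^ (l + 1) * ‖J (q n)‖ ^ 2 :=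
          Finset.sum_le_sum_of_subset_of_nonneg (Finset.filter_subset _ _)
            fun _ _ _ => by positivity
        gcongr
      _ ≤ _ := by gcongr

theorem hasSobolevBound_dunklAdjoint (hb : 0 ≤ b) {l : ℕ} {p : 𝕜[X]} {c : ℝ}
    (h : HasSobolevBound J (l + 1) p c) :
    HasSobolevBound J l (dunklAdjoint (μ : 𝕜) b p) (2 * b * (1 + 2 * |μ|) * 2 ^ l * c) := by
  obtain ⟨s, q, hq, rfl, hc⟩ := h
  refine ⟨s.map (addRightEmbedding 1),
    fun n => n.casesOn 0 fun k => dunklAdjoint (μ : 𝕜) b (q k), ?_, ?_, ?_⟩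
  · rintro (_ | n)
    · exact .zero J 0
    · exact hJ.isHermiteLevel_dunklAdjoint (hq n)
  · rw [map_sum, Finset.sum_map]
    rfl
  · rw [Finset.sum_map]
    calc ∑ n ∈ s, (((n + 1 : ℕ) : ℝ) + 1) ^ l * ‖J (dunklAdjoint (μ : 𝕜) b (q n))‖ ^ 2
      _ ≤ ∑ n ∈ s, 2 * b * (1 + 2 * |μ|) * 2 ^ l * ((n + 1) ^ (l + 1) * ‖J (q n)‖ ^ 2) := by
        refine Finset.sum_le_sum fun n _ => ?_
        calc (((n + 1 : ℕ) : ℝ) + 1) ^ l * ‖J (dunklAdjoint (μ : 𝕜) b (q n))‖ ^ 2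
          _ ≤ (2 * (n + 1)) ^ l * ((n + 1) * (2 * b * (1 + 2 * |μ|)) * ‖J (q n)‖ ^ 2) := by
            gcongr
            · push_cast
              linarith [n.cast_nonneg (α := ℝ)]
            · exact hJ.norm_dunklAdjoint_sq_le_of_isHermiteLevel hb (hq n)
          _ = _ := by
            rw [mul_pow]
            ring
      _ = 2 * b * (1 + 2 * |μ|) * 2 ^ l * ∑ n ∈ s, ((n : ℝ) + 1) ^ (l + 1) * ‖J (q n)‖ ^ 2 :=
        (Finset.mul_sum ..).symm
      _ ≤ _ := by gcongr

/-- Half the difference of the lowering and the raising operator is `gaussDunkl`, so each power of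
it costs one order of the spectral Sobolev norm. -/
theorem norm_gaussDunkl_pow_sq_le (hb : 0 ≤ b) {l : ℕ} {p : 𝕜[X]} {c : ℝ}
    (h : HasSobolevBound J l p c) :
    ‖J ((gaussDunkl (μ : 𝕜) b ^ l) p)‖ ^ 2 ≤ dunklConst μ l * b ^ l * c := by
  induction l generalizing p c with
  | zero => simpa [dunklConst] using h.norm_sq_le
  | succ l ih =>
    set v := J ((gaussDunkl (μ : 𝕜) b ^ l) (dunkl (μ : 𝕜) p))
    set w := J ((gaussDunkl (μ : 𝕜) b ^ l) (dunklAdjoint (μ : 𝕜) b p))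
    have hv : ‖v‖ ^ 2 ≤ dunklConst μ l * b ^ l * (2 * b * (1 + 2 * |μ|) * c) :=
      ih (hJ.hasSobolevBound_dunkl hb h)
    have hw : ‖w‖ ^ 2 ≤ dunklConst μ l * b ^ l * (2 * b * (1 + 2 * |μ|) * 2 ^ l * c) :=
      ih (hJ.hasSobolevBound_dunklAdjoint hb h)
    have hsplit : (2 : 𝕜) • J ((gaussDunkl (μ : 𝕜) b ^ (l + 1)) p) = v - w := by
      rw [pow_succ, Module.End.mul_apply, ← map_smul, ← map_smul, two_smul_gaussDunkl, map_sub,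
        map_sub]
    have hnorm : 2 * ‖J ((gaussDunkl (μ : 𝕜) b ^ (l + 1)) p)‖ = ‖v - w‖ := by
      rw [← hsplit, norm_smul, RCLike.norm_ofNat]
    have hC : dunklConst μ (l + 1) = dunklConst μ l * ((1 + 2 * |μ|) * (1 + 2 ^ l)) :=
      Finset.prod_range_succ _ _
    have := hnorm ▸ norm_sub_sq_le v w
    rw [hC, pow_succ b]
    linarith

/-- With `x · (d/dx)` being skew-adjoint up to a constant in `L²(|x|^{2μ} dx)`, this is a form of
the Hardy identity. -/
theorem re_inner_X_mul_gaussDeriv (p : 𝕜[X]) :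
    RCLike.re (inner 𝕜 (J (X * gaussDeriv (b : 𝕜) p)) (J p)) = -(μ + 1 / 2) * ‖J p‖ ^ 2 := by
  have hX : X * gaussDeriv (b : 𝕜) p =
      X * dunkl (μ : 𝕜) p - (μ : 𝕜) • (p - reflection p) - (b : 𝕜) • (X * (X * p)) := by
    rw [← X_mul_oddQuotient, dunkl_apply, gaussDeriv_apply, mul_sub, mul_add]
    simp only [mul_smul_comm]
    abel
  have hadj : inner 𝕜 (J (X * dunkl (μ : 𝕜) p)) (J p) + inner 𝕜 (J p) (J (X * dunkl (μ : 𝕜) p)) =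
      ((2 * b : ℝ) : 𝕜) * inner 𝕜 (J (X * p)) (J (X * p)) - inner 𝕜 (J p) (J p) -
        ((2 * μ : ℝ) : 𝕜) * inner 𝕜 (J p) (J (reflection p)) := by
    rw [hJ.inner_X_mul, hJ.inner_dunkl, dunklAdjoint_apply, dunkl_X_mul, hJ.inner_X_mul p (X * p)]
    simp only [map_sub, map_add, map_smul, inner_sub_right, inner_add_right, inner_smul_right]
    push_cast
    ring
  have hre := congrArg RCLike.re hadj
  simp only [map_sub, map_add, RCLike.re_ofReal_mul, inner_self_eq_norm_sq] at hre
  rw [inner_re_symm (J p) (J (X * dunkl (μ : 𝕜) p))] at hre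
  have hXX : RCLike.re (inner 𝕜 (J (X * (X * p))) (J p)) = ‖J (X * p)‖ ^ 2 := by
    rw [hJ.inner_X_mul, inner_self_eq_norm_sq]
  rw [hX]
  simp only [map_sub, map_smul, inner_sub_left, inner_smul_left, RCLike.conj_ofReal,
    RCLike.re_ofReal_mul, inner_self_eq_norm_sq, hXX, hJ.inner_reflection]
  linarith

theorem norm_gaussDeriv_pow_gaussDunkl_sub_reflection_le (k : ℕ) (p : 𝕜[X]) :
    ‖J ((gaussDeriv (b : 𝕜) ^ k) (gaussDunkl (μ : 𝕜) b (p - reflection p)))‖ ≤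
      2 * ‖J ((gaussDeriv (b : 𝕜) ^ k) (gaussDunkl (μ : 𝕜) b p))‖ := by
  have hrefl : ‖J ((gaussDeriv (b : 𝕜) ^ k) (gaussDunkl (μ : 𝕜) b (reflection p)))‖ =
      ‖J ((gaussDeriv (b : 𝕜) ^ k) (gaussDunkl (μ : 𝕜) b p))‖ := by
    rw [← hJ.norm_reflection ((gaussDeriv (b : 𝕜) ^ k) (gaussDunkl (μ : 𝕜) b p)),
      reflection_gaussDeriv_pow, reflection_gaussDunkl]
    simp [norm_smul]
  rw [map_sub, map_sub, map_sub, two_mul]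
  exact (norm_sub_le _ _).trans_eq (congrArg _ hrefl)

/-- A Hardy inequality: the odd part of `p` is `X * oddQuotient p / 2`, and pairing its Dunkl
derivative with `oddQuotient p` is coercive by `re_inner_X_mul_gaussDeriv`. -/
theorem norm_gaussDeriv_pow_oddQuotient_le (k : ℕ) (p : 𝕜[X]) :
    (μ + 1 / 2) * ‖J ((gaussDeriv (b : 𝕜) ^ k) (oddQuotient p))‖ ≤
      2 * ‖J ((gaussDeriv (b : 𝕜) ^ k) (gaussDunkl (μ : 𝕜) b p))‖ := by
  set g := (gaussDeriv (b : 𝕜) ^ k) (oddQuotient p)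
  set h := (gaussDeriv (b : 𝕜) ^ k) (gaussDunkl (μ : 𝕜) b (p - reflection p)) with hh
  have hg : h = X * gaussDeriv (b : 𝕜) g + ((k + 1 + 2 * μ : ℝ) : 𝕜) • g := by
    rw [hh, ← X_mul_oddQuotient, gaussDeriv_pow_gaussDunkl_X_mul_oddQuotient]
    push_cast
    rfl
  have hpair : RCLike.re (inner 𝕜 (J h) (J g)) = (k + (μ + 1 / 2)) * ‖J g‖ ^ 2 := by
    rw [hg, map_add, map_smul, inner_add_left, inner_smul_left, RCLike.conj_ofReal, map_add,
      hJ.re_inner_X_mul_gaussDeriv, RCLike.re_ofReal_mul, inner_self_eq_norm_sq]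
    ring
  refine le_trans ?_ (hJ.norm_gaussDeriv_pow_gaussDunkl_sub_reflection_le k p)
  rcases (norm_nonneg (J g)).eq_or_lt with hg0 | hg0
  · rw [← hg0, mul_zero]
    positivity
  · refine le_of_mul_le_mul_right ?_ hg0
    calc (μ + 1 / 2) * ‖J g‖ * ‖J g‖ ≤ k * ‖J g‖ ^ 2 + (μ + 1 / 2) * ‖J g‖ * ‖J g‖ :=
          le_add_of_nonneg_left (by positivity)
      _ = RCLike.re (inner 𝕜 (J h) (J g)) := by
          rw [hpair]
          ring
      _ ≤ ‖J h‖ * ‖J g‖ := re_inner_le_norm _ _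

theorem norm_gaussDeriv_pow_succ_le (hμ : -(1 / 2) < μ) (k : ℕ) (p : 𝕜[X]) :
    ‖J ((gaussDeriv (b : 𝕜) ^ (k + 1)) p)‖ ≤
      (1 + 2 * |μ| / (μ + 1 / 2)) * ‖J ((gaussDeriv (b : 𝕜) ^ k) (gaussDunkl (μ : 𝕜) b p))‖ := by
  have hμ' : 0 < μ + 1 / 2 := by linarith
  set g := (gaussDeriv (b : 𝕜) ^ k) (oddQuotient p)
  set q := (gaussDeriv (b : 𝕜) ^ k) (gaussDunkl (μ : 𝕜) b p) with hq
  have hp : (gaussDeriv (b : 𝕜) ^ (k + 1)) p = q - (μ : 𝕜) • g := by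
    rw [hq, gaussDunkl_apply, map_add, map_smul, pow_succ, Module.End.mul_apply,
      add_sub_cancel_right]
  calc ‖J ((gaussDeriv (b : 𝕜) ^ (k + 1)) p)‖ ≤ ‖J q‖ + |μ| * ‖J g‖ := by
        rw [hp, map_sub, map_smul, ← RCLike.norm_ofReal (K := 𝕜) μ, ← norm_smul]
        exact norm_sub_le _ _
    _ ≤ ‖J q‖ + |μ| * (2 * ‖J q‖ / (μ + 1 / 2)) := by
        gcongr
        rw [le_div_iff₀' hμ']
        exact hJ.norm_gaussDeriv_pow_oddQuotient_le k p
    _ = _ := by ring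

theorem norm_gaussDeriv_pow_le (hμ : -(1 / 2) < μ) (l : ℕ) (p : 𝕜[X]) :
    ‖J ((gaussDeriv (b : 𝕜) ^ l) p)‖ ≤
      (1 + 2 * |μ| / (μ + 1 / 2)) ^ l * ‖J ((gaussDunkl (μ : 𝕜) b ^ l) p)‖ := by
  have hμ' : 0 < μ + 1 / 2 := by linarith
  induction l generalizing p with
  | zero => simp
  | succ l ih =>
    calc _ ≤ (1 + 2 * |μ| / (μ + 1 / 2)) *
            ‖J ((gaussDeriv (b : 𝕜) ^ l) (gaussDunkl (μ : 𝕜) b p))‖ :=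
          hJ.norm_gaussDeriv_pow_succ_le hμ l p
      _ ≤ (1 + 2 * |μ| / (μ + 1 / 2)) * ((1 + 2 * |μ| / (μ + 1 / 2)) ^ l *
            ‖J ((gaussDunkl (μ : 𝕜) b ^ l) (gaussDunkl (μ : 𝕜) b p))‖) := by
          gcongr
          exact ih _
      _ = _ := by
          rw [pow_succ (gaussDunkl (μ : 𝕜) b), Module.End.mul_apply]
          ring

theorem norm_gaussDeriv_pow_sq_le (hμ : -(1 / 2) < μ) (hb : 0 ≤ b) {l : ℕ} {p : 𝕜[X]} {c : ℝ}
    (h : HasSobolevBound J l p c) :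
    ‖J ((gaussDeriv (b : 𝕜) ^ l) p)‖ ^ 2 ≤ derivConst μ l * b ^ l * c :=
  calc ‖J ((gaussDeriv (b : 𝕜) ^ l) p)‖ ^ 2
    _ ≤ ((1 + 2 * |μ| / (μ + 1 / 2)) ^ l * ‖J ((gaussDunkl (μ : 𝕜) b ^ l) p)‖) ^ 2 := by
      gcongr
      exact hJ.norm_gaussDeriv_pow_le hμ l p
    _ = ((1 + 2 * |μ| / (μ + 1 / 2)) ^ l) ^ 2 * ‖J ((gaussDunkl (μ : 𝕜) b ^ l) p)‖ ^ 2 :=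
      mul_pow _ _ _
    _ ≤ ((1 + 2 * |μ| / (μ + 1 / 2)) ^ l) ^ 2 * (dunklConst μ l * b ^ l * c) := by
      gcongr
      exact hJ.norm_gaussDunkl_pow_sq_le hb h
    _ = derivConst μ l * b ^ l * c := by
      rw [derivConst]
      ring

end IsHermiteEmbedding

end HermiteEmbedding

section Weight

variable {F : Type*} [NormedAddCommGroup F] [NormedSpace ℝ F]

theorem weight_absolutelyContinuous (μ : ℝ) : weight μ ≪ volume :=
  withDensity_absolutelyContinuous _ _

theorem volume_absolutelyContinuous_weight (μ : ℝ) : volume ≪ weight μ := by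
  refine withDensity_absolutelyContinuous' (by fun_prop) ?_
  filter_upwards [Measure.ae_ne volume (0 : ℝ)] with x hx
  simpa only [ne_eq, ENNReal.ofReal_eq_zero, not_le] using Real.rpow_pos_of_pos (abs_pos.2 hx) _

theorem integrable_weight_iff {μ : ℝ} {f : ℝ → F} :
    Integrable f (weight μ) ↔ Integrable fun x => |x| ^ (2 * μ) • f x := by
  rw [weight, integrable_withDensity_iff_integrable_smul' (by fun_prop) (by simp)]
  simp only [ENNReal.toReal_ofReal (Real.rpow_nonneg (abs_nonneg _) _)]

theorem integral_weight (μ : ℝ) (f : ℝ → F) :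
    ∫ x, f x ∂weight μ = ∫ x, |x| ^ (2 * μ) • f x := by
  rw [weight, integral_withDensity_eq_integral_toReal_smul (by fun_prop) (by simp)]
  simp only [ENNReal.toReal_ofReal (Real.rpow_nonneg (abs_nonneg _) _)]

theorem abs_rpow_neg_mul_abs_rpow (s : ℝ) {x : ℝ} (hx : x ≠ 0) : |x| ^ (-s) * |x| ^ s = 1 := by
  rw [← Real.rpow_add (abs_pos.2 hx), neg_add_cancel, Real.rpow_zero]

end Weight

section GaussianMoments

theorem integral_abs_rpow_mul_exp_neg_mul_sq {b s : ℝ} (hb : 0 < b) (hs : -1 < s) :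
    ∫ x : ℝ, |x| ^ s * Real.exp (-(b * x ^ 2)) = b ^ (-(s + 1) / 2) * Real.Gamma ((s + 1) / 2) := by
  have habs := integral_comp_abs (f := fun x : ℝ => x ^ s * Real.exp (-(b * x ^ 2)))
  have hIoi := integral_rpow_mul_exp_neg_mul_rpow two_pos hs hb
  simp only [Real.rpow_two, neg_mul] at hIoi
  simp only [sq_abs] at habs
  rw [habs, hIoi]
  ring

theorem integrable_abs_rpow_mul_exp_neg_mul_sq {b s : ℝ} (hb : 0 < b) (hs : -1 < s) :
    Integrable fun x : ℝ => |x| ^ s * Real.exp (-(b * x ^ 2)) := by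
  refine Integrable.of_integral_ne_zero ?_
  rw [integral_abs_rpow_mul_exp_neg_mul_sq hb hs]
  have hGamma := Real.Gamma_pos_of_pos (s := (s + 1) / 2) (by linarith)
  positivity

theorem neg_one_lt_two_mul_add_natCast {μ : ℝ} (hμ : -(1 / 2) < μ) (k : ℕ) : -1 < 2 * μ + k := by
  linarith [k.cast_nonneg (α := ℝ)]

theorem abs_rpow_mul_abs_pow_ae_eq (s : ℝ) (k : ℕ) :
    (fun x : ℝ => |x| ^ s * |x| ^ k) =ᵐ[volume] fun x => |x| ^ (s + k) := by
  filter_upwards [Measure.ae_ne volume (0 : ℝ)] with x hx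
  rw [Real.rpow_add (abs_pos.2 hx), Real.rpow_natCast]

theorem integrable_pow_mul_exp_neg_mul_sq {μ b : ℝ} (hμ : -(1 / 2) < μ) (hb : 0 < b) (k : ℕ) :
    Integrable (fun x : ℝ => x ^ k * Real.exp (-(b * x ^ 2))) (weight μ) := by
  rw [integrable_weight_iff]
  refine (integrable_abs_rpow_mul_exp_neg_mul_sq hb
    (neg_one_lt_two_mul_add_natCast hμ k)).mono' (by fun_prop) ?_
  filter_upwards [abs_rpow_mul_abs_pow_ae_eq (2 * μ) k] with x hx
  rw [← hx, smul_eq_mul, norm_mul, norm_mul, norm_pow, Real.norm_eq_abs, Real.norm_eq_abs,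
    Real.norm_eq_abs, Real.abs_exp, Real.abs_rpow_of_nonneg (abs_nonneg x), abs_abs, mul_assoc]

/-- The `k`-th moment of the measure `|x|^{2μ} e^{-b x²} dx`. -/
def gaussMoment (μ b : ℝ) (k : ℕ) : ℝ :=
  ∫ x, x ^ k * Real.exp (-(b * x ^ 2)) ∂weight μ

theorem gaussMoment_of_odd (μ b : ℝ) {k : ℕ} (hk : Odd k) : gaussMoment μ b k = 0 := by
  have h := integral_neg_eq_self
    (fun x : ℝ => |x| ^ (2 * μ) * (x ^ k * Real.exp (-(b * x ^ 2)))) volume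
  simp only [abs_neg, neg_sq, hk.neg_pow, neg_mul, mul_neg, integral_neg] at h
  rw [gaussMoment, integral_weight]
  exact self_eq_neg.1 h.symm

theorem gaussMoment_of_even {μ b : ℝ} (hμ : -(1 / 2) < μ) (hb : 0 < b) {k : ℕ} (hk : Even k) :
    gaussMoment μ b k = b ^ (-(2 * μ + k + 1) / 2) * Real.Gamma ((2 * μ + k + 1) / 2) := by
  rw [gaussMoment, integral_weight,
    ← integral_abs_rpow_mul_exp_neg_mul_sq hb (neg_one_lt_two_mul_add_natCast hμ k)]
  refine integral_congr_ae ?_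
  filter_upwards [abs_rpow_mul_abs_pow_ae_eq (2 * μ) k] with x hx
  rw [← hx, hk.pow_abs, smul_eq_mul, mul_assoc]

theorem gaussMoment_add_two {μ b : ℝ} (hμ : -(1 / 2) < μ) (hb : 0 < b) (k : ℕ) :
    2 * b * gaussMoment μ b (k + 2) = (k + 1 + 2 * μ) * gaussMoment μ b k := by
  rcases Nat.even_or_odd k with hk | hk
  · have hpos : 0 < (2 * μ + k + 1) / 2 := by linarith [neg_one_lt_two_mul_add_natCast hμ k]
    have hsucc : (2 * μ + ((k + 2 : ℕ) : ℝ) + 1) / 2 = (2 * μ + k + 1) / 2 + 1 := by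
      push_cast; ring
    rw [gaussMoment_of_even hμ hb hk, gaussMoment_of_even hμ hb (hk.add even_two), neg_div, hsucc,
      Real.Gamma_add_one hpos.ne', neg_add', Real.rpow_sub_one hb.ne', ← neg_div]
    field_simp
    ring
  · rw [gaussMoment_of_odd μ b hk, gaussMoment_of_odd μ b (hk.add_even even_two), mul_zero,
      mul_zero]

theorem weight_lt_top_of_isCompact {μ : ℝ} (hμ : -(1 / 2) < μ) {K : Set ℝ} (hK : IsCompact K) :
    weight μ K < ∞ := by
  have hexp : Integrable (fun x : ℝ => Real.exp (-x ^ 2)) (weight μ) := by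
    simpa using integrable_pow_mul_exp_neg_mul_sq hμ one_pos 0
  have hone := hexp.integrableOn.mul_continuousOn (g' := fun x => Real.exp (x ^ 2))
    (by fun_prop) hK
  simpa [← Real.exp_add] using hone

theorem weight_lt_top_of_isCompact_of_zero_notMem (μ : ℝ) {K : Set ℝ} (hK : IsCompact K)
    (h0 : 0 ∉ K) : weight μ K < ∞ := by
  have hcont : ContinuousOn (fun x : ℝ => |x| ^ (2 * μ)) K := fun x hx =>
    (continuous_abs.continuousAt.rpow_const
      (.inl (abs_ne_zero.2 (ne_of_mem_of_not_mem hx h0)))).continuousWithinAt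
  rw [weight, withDensity_apply _ hK.measurableSet]
  exact (hcont.integrableOn_compact hK).lintegral_lt_top

end GaussianMoments

section HermiteMap

open Polynomial

/-- The function `e^{-b x²/2} p(x)`. -/
def hermiteFun (b : ℝ) (p : ℂ[X]) (x : ℝ) : ℂ :=
  (Real.exp (-(b * x ^ 2) / 2) : ℂ) * p.eval (x : ℂ)

theorem hermiteFun_add (b : ℝ) (p q : ℂ[X]) :
    hermiteFun b (p + q) = hermiteFun b p + hermiteFun b q := by
  ext x
  simp only [hermiteFun, eval_add, mul_add, Pi.add_apply]

theorem hermiteFun_smul (b : ℝ) (c : ℂ) (p : ℂ[X]) :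
    hermiteFun b (c • p) = c • hermiteFun b p := by
  ext x
  simp only [hermiteFun, eval_smul, Pi.smul_apply, smul_eq_mul, mul_left_comm]

theorem continuous_hermiteFun (b : ℝ) (p : ℂ[X]) : Continuous (hermiteFun b p) := by
  unfold hermiteFun
  fun_prop

theorem inner_hermiteFun_X_pow (b : ℝ) (i j : ℕ) (x : ℝ) :
    inner ℂ (hermiteFun b (X ^ i) x) (hermiteFun b (X ^ j) x) =
      ((x ^ (i + j) * Real.exp (-(b * x ^ 2)) : ℝ) : ℂ) := by
  have hexp : Real.exp (-(b * x ^ 2)) =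
      Real.exp (-(b * x ^ 2) / 2) * Real.exp (-(b * x ^ 2) / 2) := by
    rw [← Real.exp_add, add_halves]
  rw [hexp, RCLike.inner_apply]
  simp only [hermiteFun, eval_pow, eval_X, map_mul, map_pow, Complex.conj_ofReal]
  push_cast
  ring

theorem memLp_hermiteFun {μ b : ℝ} (hμ : -(1 / 2) < μ) (hb : 0 < b) (p : ℂ[X]) :
    MemLp (hermiteFun b p) 2 (weight μ) := by
  induction p using Polynomial.induction_on' with
  | add p q hp hq =>
    rw [hermiteFun_add]
    exact hp.add hq
  | monomial n c =>
    have hnorm (x : ℝ) :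
        ‖hermiteFun b (X ^ n) x‖ ^ 2 = x ^ (n + n) * Real.exp (-(b * x ^ 2)) := by
      rw [← inner_self_eq_norm_sq (𝕜 := ℂ), inner_hermiteFun_X_pow]
      exact Complex.ofReal_re _
    rw [← C_mul_X_pow_eq_monomial, ← smul_eq_C_mul, hermiteFun_smul]
    refine MemLp.const_smul ?_ c
    rw [memLp_two_iff_integrable_sq_norm (continuous_hermiteFun _ _).aestronglyMeasurable]
    simpa only [hnorm] using integrable_pow_mul_exp_neg_mul_sq hμ hb (n + n)

/-- The class of `e^{-b x²/2} p(x)` in `L²(|x|^{2μ} dx)`, as a linear function of `p`. -/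
def hermiteMap {μ b : ℝ} (hμ : -(1 / 2) < μ) (hb : 0 < b) : ℂ[X] →ₗ[ℂ] Lp ℂ 2 (weight μ) where
  toFun p := (memLp_hermiteFun hμ hb p).toLp (hermiteFun b p)
  map_add' p q := by
    rw [← MemLp.toLp_add]
    exact MemLp.toLp_congr _ _ (by rw [hermiteFun_add])
  map_smul' c p := by
    rw [RingHom.id_apply, ← MemLp.toLp_const_smul]
    exact MemLp.toLp_congr _ _ (by rw [hermiteFun_smul])

theorem coeFn_hermiteMap {μ b : ℝ} (hμ : -(1 / 2) < μ) (hb : 0 < b) (p : ℂ[X]) :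
    hermiteMap hμ hb p =ᵐ[weight μ] hermiteFun b p :=
  (memLp_hermiteFun hμ hb p).coeFn_toLp

theorem isHermiteEmbedding_hermiteMap {μ b : ℝ} (hμ : -(1 / 2) < μ) (hb : 0 < b) :
    IsHermiteEmbedding μ b (gaussMoment μ b) (hermiteMap hμ hb) where
  inner_X_pow i j := by
    rw [L2.inner_def, gaussMoment]
    refine Eq.trans (integral_congr_ae ?_) integral_ofReal
    filter_upwards [coeFn_hermiteMap hμ hb (X ^ i), coeFn_hermiteMap hμ hb (X ^ j)] with x hi hj
    rw [hi, hj, inner_hermiteFun_X_pow]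
    rfl
  moment_of_odd _ hk := gaussMoment_of_odd μ b hk
  moment_add_two := gaussMoment_add_two hμ hb

theorem mem_hermiteSpace_iff {μ β : ℝ} (hμ : -(1 / 2) < μ) (hβ : 0 < β ^ 2) {n : ℕ}
    {φ : Lp ℂ 2 (weight μ)} :
    φ ∈ hermiteSpace μ β n ↔ ∃ p ∈ degreeLT ℂ (n + 1), hermiteMap hμ hβ p = φ := by
  rw [degreeLT_succ_eq_degreeLE]
  constructor
  · rintro ⟨p, hp, h⟩
    exact ⟨p, hp, Lp.ext ((coeFn_hermiteMap hμ hβ p).trans h.symm)⟩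
  · rintro ⟨p, hp, rfl⟩
    exact ⟨p, hp, coeFn_hermiteMap hμ hβ p⟩

end HermiteMap

section WeightPairing

variable {F : Type*} [NormedAddCommGroup F] [NormedSpace ℝ F]

theorem weight_absolutelyContinuous_weight (μ ν : ℝ) : weight μ ≪ weight ν :=
  (weight_absolutelyContinuous μ).trans (volume_absolutelyContinuous_weight ν)

theorem memLp_abs_rpow_smul {μ : ℝ} {φ : ℝ → F} (hφ : MemLp φ 2 (weight (-μ))) :
    MemLp (fun x => |x| ^ (-(2 * μ)) • φ x) 2 (weight μ) := by
  have hmeas : AEStronglyMeasurable (fun x => |x| ^ (-(2 * μ)) • φ x) (weight μ) :=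
    Measurable.aestronglyMeasurable (by fun_prop) |>.smul
      (hφ.1.mono_ac (weight_absolutelyContinuous_weight μ (-μ)))
  rw [memLp_two_iff_integrable_sq_norm hφ.1, integrable_weight_iff] at hφ
  rw [memLp_two_iff_integrable_sq_norm hmeas, integrable_weight_iff]
  refine hφ.congr ?_
  filter_upwards [Measure.ae_ne volume (0 : ℝ)] with x hx
  rw [norm_smul, Real.norm_of_nonneg (Real.rpow_nonneg (abs_nonneg x) _), mul_neg, smul_eq_mul,
    smul_eq_mul]
  linear_combination
    -(|x| ^ (-(2 * μ)) * ‖φ x‖ ^ 2) * abs_rpow_neg_mul_abs_rpow (2 * μ) hx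

theorem exists_inner_eq_integral_mul {μ : ℝ} {φ : ℝ → ℂ} (hφ : MemLp φ 2 (weight (-μ))) :
    ∃ ψ : Lp ℂ 2 (weight μ), ∀ v : Lp ℂ 2 (weight μ),
      Integrable (fun x => v x * φ x) ∧ inner ℂ ψ v = ∫ x, v x * φ x := by
  have hψ : MemLp (fun x => |x| ^ (-(2 * μ)) • star (φ x)) 2 (weight μ) :=
    memLp_abs_rpow_smul hφ.star
  have hinner (v : Lp ℂ 2 (weight μ)) :
      (fun x => |x| ^ (2 * μ) • inner ℂ (hψ.toLp _ x) (v x)) =ᵐ[volume] fun x => v x * φ x := by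
    filter_upwards [Measure.ae_ne volume (0 : ℝ),
      (volume_absolutelyContinuous_weight μ).ae_eq hψ.coeFn_toLp] with x hx hψx
    rw [hψx, RCLike.inner_apply, Complex.star_def, Complex.real_smul, Complex.real_smul, map_mul,
      Complex.conj_ofReal, Complex.conj_conj]
    have hone : ((|x| ^ (-(2 * μ)) : ℝ) : ℂ) * ((|x| ^ (2 * μ) : ℝ) : ℂ) = 1 := by
      exact_mod_cast abs_rpow_neg_mul_abs_rpow (2 * μ) hx
    linear_combination (v x * φ x) * hone
  refine ⟨hψ.toLp _, fun v => ⟨?_, ?_⟩⟩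
  · exact (integrable_weight_iff.1 (L2.integrable_inner (𝕜 := ℂ) _ v)).congr (hinner v)
  · rw [L2.inner_def, integral_weight, integral_congr_ae (hinner v)]

theorem memLp_of_measure_tsupport_lt_top {X E : Type*} [TopologicalSpace X] [MeasurableSpace X]
    [OpensMeasurableSpace X] [NormedAddCommGroup E] [SecondCountableTopologyEither X E]
    {ν : Measure X} {φ : X → E} (hφ : Continuous φ) (hc : HasCompactSupport φ)
    (hν : ν (tsupport φ) < ∞) (p : ℝ≥0∞) : MemLp φ p ν := by
  obtain ⟨C, hC⟩ := hc.exists_bound_of_continuous hφ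
  have : IsFiniteMeasure (ν.restrict (tsupport φ)) := ⟨by rwa [Measure.restrict_apply_univ]⟩
  rw [← indicator_eq_self.2 (subset_tsupport φ),
    memLp_indicator_iff_restrict (isClosed_tsupport φ).measurableSet]
  exact MemLp.of_bound hφ.aestronglyMeasurable C (ae_of_all _ hC)

theorem locallyIntegrableOn_Lp_weight {μ : ℝ} {Ω : Set ℝ} (hΩ : IsOpen Ω)
    (hfin : ∀ K ⊆ Ω, IsCompact K → weight (-μ) K < ∞) (v : Lp ℂ 2 (weight μ)) :
    LocallyIntegrableOn v Ω := by
  rw [locallyIntegrableOn_iff hΩ.isLocallyClosed]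
  intro K hKΩ hK
  have hone : MemLp (K.indicator fun _ => (1 : ℂ)) 2 (weight (-μ)) :=
    memLp_indicator_const 2 hK.measurableSet 1 (.inr (hfin K hKΩ hK).ne)
  obtain ⟨ψ, hψ⟩ := exists_inner_eq_integral_mul hone
  rw [← integrable_indicator_iff hK.measurableSet]
  simpa only [← indicator_mul_right, mul_one] using (hψ v).1

end WeightPairing

section WeakDeriv

variable {Ω : Set ℝ} {l : ℕ} {v g : ℝ → ℂ}

theorem tsupport_iteratedDeriv_subset (k : ℕ) (φ : ℝ → ℂ) :
    tsupport (iteratedDeriv k φ) ⊆ tsupport φ := by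
  induction k with
  | zero => rw [iteratedDeriv_zero]
  | succ k ih =>
    rw [iteratedDeriv_succ]
    exact (tsupport_deriv_subset (𝕜 := ℝ)).trans ih

theorem hasCompactSupport_iteratedDeriv {φ : ℝ → ℂ} (hφ : HasCompactSupport φ) (k : ℕ) :
    HasCompactSupport (iteratedDeriv k φ) :=
  hφ.of_isClosed_subset (isClosed_tsupport _) (tsupport_iteratedDeriv_subset k φ)

namespace HasWeakDeriv

theorem congr_ae {v' g' : ℝ → ℂ} (h : HasWeakDeriv Ω l v g) (hv : v =ᵐ[volume] v')
    (hg : g =ᵐ[volume] g') : HasWeakDeriv Ω l v' g' := by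
  refine ⟨h.1.congr (ae_restrict_of_ae hv), h.2.1.congr (ae_restrict_of_ae hg),
    fun φ hφ hc hs => ?_⟩
  have hmul {f f' χ : ℝ → ℂ} (hf : f =ᵐ[volume] f') : ∫ x, f' x * χ x = ∫ x, f x * χ x :=
    (integral_congr_ae (hf.mul .rfl)).symm
  rw [hmul hv, hmul hg]
  exact h.2.2 φ hφ hc hs

theorem of_hasDerivAt {w : ℕ → ℝ → ℂ} (hw : ∀ k x, HasDerivAt (w k) (w (k + 1) x) x) :
    HasWeakDeriv Ω l (w 0) (w l) := by
  have hcont (k : ℕ) : Continuous (w k) :=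
    continuous_iff_continuousAt.2 fun x => (hw k x).continuousAt
  refine ⟨(hcont 0).locallyIntegrable.locallyIntegrableOn Ω,
    (hcont l).locallyIntegrable.locallyIntegrableOn Ω, fun φ hφ hc _ => ?_⟩
  induction l generalizing w with
  | zero => simp
  | succ l ih =>
    have hdiff (k : ℕ) : Differentiable ℝ (iteratedDeriv k φ) :=
      hφ.differentiable_iteratedDeriv k (by exact_mod_cast WithTop.coe_lt_top _)
    have hint (i k : ℕ) : Integrable (w i * iteratedDeriv k φ) :=
      ((hcont i).mul (hdiff k).continuous).integrable_of_hasCompactSupport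
        (hasCompactSupport_iteratedDeriv hc k).mul_left
    rw [integral_mul_deriv_eq_deriv_mul_of_integrable (fun x _ => hw 0 x)
      (fun x _ => by rw [iteratedDeriv_succ]; exact (hdiff l x).hasDerivAt)
      (hint 0 (l + 1)) (hint 1 l) (hint 0 l),
      ih (fun k => hw (k + 1)) fun k => hcont (k + 1), pow_succ, mul_neg_one, neg_mul]

theorem of_tendsto {μ : ℝ} (hΩ : IsOpen Ω) (hfin : ∀ K ⊆ Ω, IsCompact K → weight (-μ) K < ∞)
    {ι : Type*} {𝓕 : Filter ι} [𝓕.NeBot] {w h : ι → Lp ℂ 2 (weight μ)} {v g : Lp ℂ 2 (weight μ)}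
    (hwh : ∀ i, HasWeakDeriv Ω l (w i) (h i)) (hw : 𝓕.Tendsto w (nhds v))
    (hh : 𝓕.Tendsto h (nhds g)) : HasWeakDeriv Ω l v g := by
  refine ⟨locallyIntegrableOn_Lp_weight hΩ hfin v, locallyIntegrableOn_Lp_weight hΩ hfin g,
    fun φ hφ hc hs => ?_⟩
  have hpair {χ : ℝ → ℂ} (hχ : Continuous χ) (hcχ : HasCompactSupport χ) (hsχ : tsupport χ ⊆ Ω) :=
    exists_inner_eq_integral_mul (memLp_of_measure_tsupport_lt_top hχ hcχ (hfin _ hsχ hcχ) 2)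
  obtain ⟨ψ, hψ⟩ := hpair hφ.continuous hc hs
  obtain ⟨ψ', hψ'⟩ := hpair (hφ.continuous_iteratedDeriv l (by exact_mod_cast le_top))
    (hasCompactSupport_iteratedDeriv hc l) ((tsupport_iteratedDeriv_subset l φ).trans hs)
  rw [← (hψ g).2, ← (hψ' v).2]
  refine tendsto_nhds_unique (tendsto_const_nhds.inner hw)
    (((tendsto_const_nhds.inner hh).const_mul _).congr fun i => ?_)
  rw [(hψ _).2, (hψ' _).2, (hwh i).2.2 φ hφ hc hs]

theorem ae_eq_restrict {g' : ℝ → ℂ} (hΩ : IsOpen Ω) (h : HasWeakDeriv Ω l v g)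
    (h' : HasWeakDeriv Ω l v g') : g =ᵐ[volume.restrict Ω] g' := by
  have hint {f : ℝ → ℂ} (hf : LocallyIntegrableOn f Ω) {φ : ℝ → ℝ} (hφ : Continuous φ)
      (hc : HasCompactSupport φ) (hs : tsupport φ ⊆ Ω) : Integrable fun x => φ x • f x := by
    refine (integrableOn_iff_integrable_of_support_subset
      ((Function.support_smul_subset_left φ f).trans (subset_tsupport φ))).1 ?_
    exact (hf.integrableOn_compact_subset hs hc).continuousOn_smul hφ.continuousOn hc
  rw [Filter.EventuallyEq, ae_restrict_iff' hΩ.measurableSet]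
  simp only [← sub_eq_zero (a := g _)]
  refine hΩ.ae_eq_zero_of_integral_contDiff_smul_eq_zero (h.2.1.sub h'.2.1) fun φ hφ hc hs => ?_
  have hsupp : tsupport (fun x => (φ x : ℂ)) = tsupport φ :=
    congrArg closure (Function.support_comp_eq _ Complex.ofReal_eq_zero φ)
  have htest {f : ℝ → ℂ} (hf : HasWeakDeriv Ω l v f) :
      ∫ x, v x * iteratedDeriv l (fun x => (φ x : ℂ)) x = (-1) ^ l * ∫ x, f x * φ x :=
    hf.2.2 _ (Complex.ofRealCLM.contDiff.comp hφ) (hc.comp_left Complex.ofReal_zero)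
      (hsupp.trans_subset hs)
  simp only [smul_sub]
  rw [integral_sub (hint h.2.1 hφ.continuous hc hs) (hint h'.2.1 hφ.continuous hc hs), sub_eq_zero]
  simpa only [Complex.real_smul, mul_comm] using
    mul_left_cancel₀ (pow_ne_zero l (neg_ne_zero.2 one_ne_zero)) ((htest h).symm.trans (htest h'))

theorem ae_eq_weight {g' : ℝ → ℂ} (h : HasWeakDeriv {0}ᶜ l v g) (h' : HasWeakDeriv {0}ᶜ l v g')
    (μ : ℝ) : g =ᵐ[weight μ] g' := by
  refine (weight_absolutelyContinuous μ).ae_eq ?_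
  rw [← Measure.restrict_eq_self_of_ae_mem (Measure.ae_ne volume (0 : ℝ))]
  exact h.ae_eq_restrict isOpen_compl_singleton h'

end HasWeakDeriv

theorem hasDerivAt_hermiteFun (b : ℝ) (p : Polynomial ℂ) (x : ℝ) :
    HasDerivAt (hermiteFun b p) (hermiteFun b (gaussDeriv (b : ℂ) p) x) x := by
  have hexp : HasDerivAt (fun y : ℝ => Real.exp (-(b * y ^ 2) / 2))
      (Real.exp (-(b * x ^ 2) / 2) * (-(b * x))) x :=
    ((((hasDerivAt_pow 2 x).const_mul b).neg.div_const 2).congr_deriv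
      (by push_cast; ring)).exp
  refine (hexp.ofReal_comp.mul (p.hasDerivAt (x : ℂ)).comp_ofReal).congr_deriv ?_
  simp only [hermiteFun, gaussDeriv_apply, Polynomial.eval_sub, Polynomial.eval_smul,
    Polynomial.eval_mul, Polynomial.eval_X, smul_eq_mul]
  push_cast
  ring

theorem hasWeakDeriv_hermiteMap {μ b : ℝ} (hμ : -(1 / 2) < μ) (hb : 0 < b) (Ω : Set ℝ) (l : ℕ)
    (p : Polynomial ℂ) :
    HasWeakDeriv Ω l (hermiteMap hμ hb p) (hermiteMap hμ hb ((gaussDeriv (b : ℂ) ^ l) p)) := by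
  have hcoe (q : Polynomial ℂ) : hermiteFun b q =ᵐ[volume] hermiteMap hμ hb q :=
    ((volume_absolutelyContinuous_weight μ).ae_eq (coeFn_hermiteMap hμ hb q)).symm
  refine HasWeakDeriv.congr_ae (HasWeakDeriv.of_hasDerivAt
    (w := fun k => hermiteFun b ((gaussDeriv (b : ℂ) ^ k) p)) fun k x => ?_) (hcoe p) (hcoe _)
  simpa only [pow_succ', Module.End.mul_apply] using hasDerivAt_hermiteFun b _ x

end WeakDeriv

section Summation

theorem summable_of_norm_sum_sq_le {ι E : Type*} [NormedAddCommGroup E] [CompleteSpace E]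
    {f : ι → E} {a : ι → ℝ} {K : ℝ} (hfa : ∀ s : Finset ι, ‖∑ i ∈ s, f i‖ ^ 2 ≤ K * ∑ i ∈ s, a i)
    (ha : Summable a) : Summable f := by
  rw [summable_iff_vanishing_norm]
  intro ε hε
  obtain ⟨s, hs⟩ := summable_iff_vanishing_norm.1 (ha.mul_left K) (ε ^ 2) (by positivity)
  refine ⟨s, fun t ht => lt_of_pow_lt_pow_left₀ 2 hε.le ?_⟩
  calc ‖∑ i ∈ t, f i‖ ^ 2
    _ ≤ ∑ i ∈ t, K * a i := (hfa t).trans_eq (Finset.mul_sum ..)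
    _ ≤ ‖∑ i ∈ t, K * a i‖ := Real.le_norm_self _
    _ < ε ^ 2 := hs t ht

theorem sum_mul_le_lintegral_natCeil {ν : Measure ℝ} {a c : ℕ → ℝ≥0∞} (hc : Monotone c)
    (ha : ∀ n m, ∑ k ∈ Finset.Ico n m, a k ≤ ν (Ioi n)) (m : ℕ) :
    ∑ k ∈ Finset.range m, c (k + 1) * a k ≤ ∫⁻ x, c ⌈x⌉₊ ∂ν := by
  have hsum (n : ℕ) : c n = c 0 + ∑ j ∈ Finset.range n, (c (j + 1) - c j) := by
    induction n with
    | zero => simp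
    | succ n ih =>
      rw [Finset.sum_range_succ, ← add_assoc, ← ih, add_tsub_cancel_of_le (hc n.le_succ)]
  have hlayer (x : ℝ) : c 0 + ∑ j ∈ Finset.range m,
      (Ioi (j : ℝ)).indicator (fun _ => c (j + 1) - c j) x ≤ c ⌈x⌉₊ := by
    rw [hsum ⌈x⌉₊]
    simp only [indicator_apply, mem_Ioi, ← Nat.lt_ceil, ← Finset.sum_filter]
    gcongr
    intro j hj
    exact Finset.mem_range.2 (Finset.mem_filter.1 hj).2
  calc ∑ k ∈ Finset.range m, c (k + 1) * a k
    _ = c 0 * ∑ k ∈ Finset.range m, a k +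
        ∑ j ∈ Finset.range m, (c (j + 1) - c j) * ∑ k ∈ Finset.Ico j m, a k := by
      have hmul (k : ℕ) : c (k + 1) * a k =
          c 0 * a k + ∑ j ∈ Finset.Ico 0 (k + 1), (c (j + 1) - c j) * a k := by
        rw [hsum, add_mul, Finset.sum_mul, Finset.range_eq_Ico]
      simp only [hmul, Finset.sum_add_distrib, Finset.mul_sum, Finset.range_eq_Ico]
      rw [Finset.sum_Ico_Ico_comm]
    _ ≤ c 0 * ν univ + ∑ j ∈ Finset.range m, (c (j + 1) - c j) * ν (Ioi j) := by
      gcongr with j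
      · rw [Finset.range_eq_Ico]
        exact (ha 0 m).trans (measure_mono (subset_univ _))
      · exact ha j m
    _ = ∫⁻ x, c 0 + ∑ j ∈ Finset.range m,
        (Ioi (j : ℝ)).indicator (fun _ => c (j + 1) - c j) x ∂ν := by
      rw [lintegral_add_left measurable_const, lintegral_const, lintegral_finsetSum _ fun j _ =>
        measurable_const.indicator measurableSet_Ioi]
      simp only [lintegral_indicator_const measurableSet_Ioi]
    _ ≤ ∫⁻ x, c ⌈x⌉₊ ∂ν := lintegral_mono hlayer

theorem tendsto_measure_Ioi_natCast (ν : Measure ℝ) [IsFiniteMeasure ν] :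
    Filter.Tendsto (fun n : ℕ => ν (Ioi (n : ℝ))) Filter.atTop (nhds 0) := by
  have hempty : ⋂ n : ℕ, Ioi (n : ℝ) = ∅ :=
    eq_empty_of_forall_notMem fun x hx =>
      (exists_nat_ge x).elim fun n hn => (mem_iInter.1 hx n).not_ge hn
  rw [← measure_empty (μ := ν), ← hempty]
  exact tendsto_measure_iInter_atTop (fun n => measurableSet_Ioi.nullMeasurableSet)
    (fun m n h => Ioi_subset_Ioi (by exact_mod_cast h)) ⟨0, measure_ne_top _ _⟩

end Summation

section HermiteExpansion

open Polynomial

theorem hermiteSpace_mono {μ β : ℝ} : Monotone (hermiteSpace μ β) := fun _ _ h _ ⟨p, hp, hφ⟩ =>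
  ⟨p, degreeLE_mono (by exact_mod_cast h) hp, hφ⟩

theorem hermiteProj_mem (μ β : ℝ) (n : ℕ) (u : Lp ℂ 2 (weight μ)) :
    hermiteProj μ β n u ∈ hermiteSpace μ β n :=
  Submodule.starProjection_apply_mem _ _

theorem hermiteProj_of_mem {μ β : ℝ} {n : ℕ} {u : Lp ℂ 2 (weight μ)}
    (hu : u ∈ hermiteSpace μ β n) : hermiteProj μ β n u = u :=
  Submodule.starProjection_eq_self_iff.2 hu

theorem hermiteProj_hermiteProj_of_le {μ β : ℝ} {m n : ℕ} (h : m ≤ n) (u : Lp ℂ 2 (weight μ)) :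
    hermiteProj μ β m (hermiteProj μ β n u) = hermiteProj μ β m u :=
  congrArg (· u) (Submodule.starProjection_comp_starProjection_of_le (hermiteSpace_mono h))

theorem hermiteProj_sub (μ β : ℝ) (n : ℕ) (u v : Lp ℂ 2 (weight μ)) :
    hermiteProj μ β n (u - v) = hermiteProj μ β n u - hermiteProj μ β n v :=
  map_sub _ u v

theorem inner_sub_hermiteProj {μ β : ℝ} {n : ℕ} {w : Lp ℂ 2 (weight μ)}
    (hw : w ∈ hermiteSpace μ β n) (u : Lp ℂ 2 (weight μ)) :
    inner ℂ w (u - hermiteProj μ β n u) = 0 :=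
  inner_eq_zero_symm.1 (Submodule.starProjection_inner_eq_zero u w hw)

theorem norm_hermiteProj_sub_hermiteProj_le {μ β : ℝ} {m n : ℕ} (h : m ≤ n)
    (u : Lp ℂ 2 (weight μ)) :
    ‖hermiteProj μ β n u - hermiteProj μ β m u‖ ≤ ‖u - hermiteProj μ β m u‖ := by
  rw [← hermiteProj_of_mem (hermiteSpace_mono h (hermiteProj_mem μ β m u)), ← hermiteProj_sub,
    hermiteProj_of_mem (hermiteSpace_mono h (hermiteProj_mem μ β m u))]
  exact Submodule.norm_starProjection_apply_le _ _

theorem sub_hermiteProj_sub_hermiteProj (μ β : ℝ) (n N : ℕ) (u : Lp ℂ 2 (weight μ)) :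
    u - hermiteProj μ β N u - hermiteProj μ β n (u - hermiteProj μ β N u) =
      u - hermiteProj μ β (max n N) u := by
  rw [hermiteProj_sub]
  rcases le_total n N with h | h
  · rw [hermiteProj_hermiteProj_of_le h, sub_self, sub_zero, max_eq_right h]
  · rw [hermiteProj_of_mem (hermiteSpace_mono h (hermiteProj_mem μ β N u)), max_eq_left h]
    abel

theorem exists_isHermiteLevel_hermiteProj_eq {μ β : ℝ} (hμ : -(1 / 2) < μ) (hβ : 0 < β ^ 2)
    (u : Lp ℂ 2 (weight μ)) :
    ∃ p : ℕ → ℂ[X], (∀ n, IsHermiteLevel (hermiteMap hμ hβ) n (p n)) ∧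
      ∀ n, hermiteProj μ β n u = hermiteMap hμ hβ (∑ k ∈ Finset.range (n + 1), p k) := by
  have hmem (n : ℕ) : ∃ p ∈ degreeLT ℂ (n + 1), hermiteMap hμ hβ p = hermiteProj μ β n u :=
    (mem_hermiteSpace_iff hμ hβ).1 (hermiteProj_mem μ β n u)
  choose P hPdeg hP using hmem
  refine ⟨fun n => n.casesOn (P 0) fun k => P (k + 1) - P k, ?_, fun n => ?_⟩
  · rintro (_ | n)
    · refine ⟨hPdeg 0, fun q hq => ?_⟩
      rw [degree_eq_bot.1 (Nat.WithBot.lt_zero_iff.1 (mem_degreeLT.1 hq)), map_zero,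
        inner_zero_left]
    · refine ⟨sub_mem (hPdeg (n + 1)) (degreeLT_mono (n + 1).le_succ (hPdeg n)), fun q hq => ?_⟩
      have hq' : hermiteMap hμ hβ q ∈ hermiteSpace μ β n :=
        (mem_hermiteSpace_iff hμ hβ).2 ⟨q, hq, rfl⟩
      rw [map_sub, hP, hP, ← sub_sub_sub_cancel_left _ _ u, inner_sub_right,
        inner_sub_hermiteProj hq', inner_sub_hermiteProj (hermiteSpace_mono n.le_succ hq'),
        sub_self]
  · rw [← hP, Finset.sum_range_succ', Finset.sum_range_sub]
    exact congrArg _ (sub_add_cancel (P n) (P 0)).symm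

theorem exists_hasWeakDeriv_of_tendsto {μ b : ℝ} (hμ : -(1 / 2) < μ) (hb : 0 < b) {l : ℕ}
    {p : ℕ → ℂ[X]} (hp : ∀ n, IsHermiteLevel (hermiteMap hμ hb) n (p n)) {v : Lp ℂ 2 (weight μ)}
    (hv : Filter.Tendsto (fun n => hermiteMap hμ hb (∑ k ∈ Finset.range n, p k)) Filter.atTop
      (nhds v)) {c : ℝ}
    (hc : ∀ n, ∑ k ∈ Finset.range n, ((k : ℝ) + 1) ^ l * ‖hermiteMap hμ hb (p k)‖ ^ 2 ≤ c) :
    ∃ G : Lp ℂ 2 (weight μ), ‖G‖ ^ 2 ≤ derivConst μ l * b ^ l * c ∧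
      ∀ Ω : Set ℝ, IsOpen Ω → (∀ K ⊆ Ω, IsCompact K → weight (-μ) K < ∞) →
        HasWeakDeriv Ω l v G := by
  have hbound (s : Finset ℕ) :
      ‖∑ k ∈ s, hermiteMap hμ hb ((gaussDeriv (b : ℂ) ^ l) (p k))‖ ^ 2 ≤
        derivConst μ l * b ^ l * ∑ k ∈ s, ((k : ℝ) + 1) ^ l * ‖hermiteMap hμ hb (p k)‖ ^ 2 := by
    simp only [← map_sum]
    exact (isHermiteEmbedding_hermiteMap hμ hb).norm_gaussDeriv_pow_sq_le hμ hb.le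
      ⟨s, p, hp, rfl, le_rfl⟩
  obtain ⟨G, hG⟩ := summable_of_norm_sum_sq_le hbound
    (summable_of_sum_range_le (fun k => by positivity) hc)
  have hK : 0 ≤ derivConst μ l * b ^ l := mul_nonneg (derivConst_pos hμ l).le (by positivity)
  refine ⟨G, ?_, fun Ω hΩ hfin => ?_⟩
  · exact le_of_tendsto' (hG.tendsto_sum_nat.norm.pow 2) fun n =>
      (hbound _).trans (mul_le_mul_of_nonneg_left (hc n) hK)
  · refine HasWeakDeriv.of_tendsto hΩ hfin (fun n => hasWeakDeriv_hermiteMap hμ hb Ω l _) hv ?_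
    simpa only [map_sum] using hG.tendsto_sum_nat

end HermiteExpansion

section TruncationError

variable {μ β : ℝ} {l : ℕ} {ν : Measure ℝ} {u : Lp ℂ 2 (weight μ)}

theorem tendsto_hermiteProj [IsFiniteMeasure ν]
    (hu : ∀ n : ℕ, ‖u - hermiteProj μ β n u‖ₑ ^ 2 ≤ ν (Ioi n)) :
    Filter.Tendsto (fun n => hermiteProj μ β n u) Filter.atTop (nhds u) := by
  have hsq : Filter.Tendsto (fun n => ‖u - hermiteProj μ β n u‖ₑ ^ 2) Filter.atTop (nhds 0) :=
    tendsto_of_tendsto_of_tendsto_of_le_of_le tendsto_const_nhds (tendsto_measure_Ioi_natCast ν)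
      (fun _ => zero_le) hu
  rw [tendsto_iff_edist_tendsto_0]
  simpa only [edist_comm, edist_eq_enorm_sub, ENNReal.pow_rpow_inv_natCast two_ne_zero,
    ENNReal.zero_rpow_of_pos (inv_pos.2 (Nat.cast_pos.2 zero_lt_two))] using
    hsq.ennrpow_const ((2 : ℕ) : ℝ)⁻¹

theorem sum_Ico_enorm_sq_le (hμ : -(1 / 2) < μ) (hβ : 0 < β ^ 2) {p : ℕ → Polynomial ℂ}
    (hp : ∀ n, IsHermiteLevel (hermiteMap hμ hβ) n (p n))
    (hproj : ∀ n, hermiteProj μ β n u = hermiteMap hμ hβ (∑ k ∈ Finset.range (n + 1), p k))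
    (m n : ℕ) :
    ∑ k ∈ Finset.Ico m n, ‖hermiteMap hμ hβ (p (k + 1))‖ₑ ^ 2 ≤ ‖u - hermiteProj μ β m u‖ₑ ^ 2 := by
  set J := hermiteMap hμ hβ
  rcases le_total n m with h | h
  · simp [Finset.Ico_eq_empty_of_le h]
  have hincr : hermiteProj μ β n u - hermiteProj μ β m u =
      J (∑ k ∈ Finset.Ico (m + 1) (n + 1), p k) := by
    rw [hproj, hproj, ← map_sub, Finset.sum_Ico_eq_sub _ (Nat.succ_le_succ h)]
  calc ∑ k ∈ Finset.Ico m n, ‖J (p (k + 1))‖ₑ ^ 2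
    _ = ‖hermiteProj μ β n u - hermiteProj μ β m u‖ₑ ^ 2 := by
      rw [hincr, Finset.sum_Ico_add' (fun k => ‖J (p k)‖ₑ ^ 2)]
      simp only [← ofReal_norm, ← ENNReal.ofReal_pow (norm_nonneg _),
        norm_sum_sq_of_isHermiteLevel hp]
      rw [ENNReal.ofReal_sum_of_nonneg fun _ _ => by positivity]
    _ ≤ ‖u - hermiteProj μ β m u‖ₑ ^ 2 := by
      gcongr
      exact enorm_le_iff_norm_le.2 (norm_hermiteProj_sub_hermiteProj_le h u)

theorem sum_pow_mul_norm_sq_le (hμ : -(1 / 2) < μ) (hβ : 0 < β ^ 2) {p : ℕ → Polynomial ℂ}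
    (hp : ∀ n, IsHermiteLevel (hermiteMap hμ hβ) n (p n))
    (hproj : ∀ n, hermiteProj μ β n u = hermiteMap hμ hβ (∑ k ∈ Finset.range (n + 1), p k))
    (hu0 : hermiteProj μ β 0 u = 0) (hu : ∀ n : ℕ, ‖u - hermiteProj μ β n u‖ₑ ^ 2 ≤ ν (Ioi n))
    (hfin : ∫⁻ x, (⌈x⌉₊ + 1 : ℝ≥0∞) ^ l ∂ν ≠ ∞) (n : ℕ) :
    ∑ k ∈ Finset.range n, ((k : ℝ) + 1) ^ l * ‖hermiteMap hμ hβ (p k)‖ ^ 2 ≤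
      (∫⁻ x, (⌈x⌉₊ + 1 : ℝ≥0∞) ^ l ∂ν).toReal := by
  set J := hermiteMap hμ hβ
  have hmono : Monotone fun n : ℕ => (n + 1 : ℝ≥0∞) ^ l := fun m n h => by
    dsimp only
    gcongr
  have hp0 : J (p 0) = 0 := by simpa [hu0] using (hproj 0).symm
  rw [← ENNReal.ofReal_le_iff_le_toReal hfin]
  calc ENNReal.ofReal (∑ k ∈ Finset.range n, ((k : ℝ) + 1) ^ l * ‖J (p k)‖ ^ 2)
    _ ≤ ENNReal.ofReal (∑ k ∈ Finset.range (n + 1), ((k : ℝ) + 1) ^ l * ‖J (p k)‖ ^ 2) :=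
      ENNReal.ofReal_le_ofReal (Finset.sum_le_sum_of_subset_of_nonneg
        (Finset.range_mono n.le_succ) fun _ _ _ => by positivity)
    _ = ∑ k ∈ Finset.range n, ((k + 1 : ℕ) + 1 : ℝ≥0∞) ^ l * ‖J (p (k + 1))‖ₑ ^ 2 := by
      rw [Finset.sum_range_succ', hp0, norm_zero, zero_pow two_ne_zero, mul_zero, add_zero,
        ENNReal.ofReal_sum_of_nonneg fun _ _ => by positivity]
      refine Finset.sum_congr rfl fun k _ => ?_
      rw [ENNReal.ofReal_mul (by positivity), ENNReal.ofReal_pow (by positivity),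
        ENNReal.ofReal_add (by positivity) zero_le_one, ENNReal.ofReal_natCast,
        ENNReal.ofReal_one, ENNReal.ofReal_pow (norm_nonneg _), ofReal_norm]
    _ ≤ ∫⁻ x, (⌈x⌉₊ + 1 : ℝ≥0∞) ^ l ∂ν :=
      sum_mul_le_lintegral_natCeil hmono
        (fun m n => (sum_Ico_enorm_sq_le hμ hβ hp hproj m n).trans (hu m)) n

theorem exists_hasWeakDeriv_of_hermiteProj_zero (hμ : -(1 / 2) < μ) (hβ : 0 < β ^ 2)
    (hu0 : hermiteProj μ β 0 u = 0) (hu : ∀ n : ℕ, ‖u - hermiteProj μ β n u‖ₑ ^ 2 ≤ ν (Ioi n))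
    (hfin : ∫⁻ x, (⌈x⌉₊ + 1 : ℝ≥0∞) ^ l ∂ν ≠ ∞) :
    ∃ G : Lp ℂ 2 (weight μ),
      ‖G‖ₑ ^ 2 ≤ ENNReal.ofReal (derivConst μ l * (β ^ 2) ^ l) *
        ∫⁻ x, (⌈x⌉₊ + 1 : ℝ≥0∞) ^ l ∂ν ∧
      ∀ Ω : Set ℝ, IsOpen Ω → (∀ K ⊆ Ω, IsCompact K → weight (-μ) K < ∞) →
        HasWeakDeriv Ω l u G := by
  have hν : ν univ ≤ ∫⁻ x, (⌈x⌉₊ + 1 : ℝ≥0∞) ^ l ∂ν := by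
    rw [← lintegral_one]
    exact lintegral_mono fun x => one_le_pow₀ le_add_self
  have : IsFiniteMeasure ν := ⟨hν.trans_lt hfin.lt_top⟩
  obtain ⟨p, hp, hproj⟩ := exists_isHermiteLevel_hermiteProj_eq hμ hβ u
  have hlim : Filter.Tendsto (fun n => hermiteMap hμ hβ (∑ k ∈ Finset.range n, p k))
      Filter.atTop (nhds u) := by
    rw [← Filter.tendsto_add_atTop_iff_nat 1]
    simpa only [hproj] using tendsto_hermiteProj hu
  obtain ⟨G, hGnorm, hG⟩ := exists_hasWeakDeriv_of_tendsto hμ hβ hp hlim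
    (sum_pow_mul_norm_sq_le hμ hβ hp hproj hu0 hu hfin)
  refine ⟨G, ?_, hG⟩
  have hK : 0 ≤ derivConst μ l * (β ^ 2) ^ l := mul_nonneg (derivConst_pos hμ l).le (by positivity)
  rw [← ENNReal.ofReal_toReal hfin, ← ENNReal.ofReal_mul hK, ← ofReal_norm,
    ← ENNReal.ofReal_pow (norm_nonneg _)]
  exact ENNReal.ofReal_le_ofReal hGnorm

theorem exists_hasWeakDeriv_sub_hermiteProj (hμ : -(1 / 2) < μ) (hβ : 0 < β ^ 2) {N : ℕ}
    (hN : 1 ≤ N) (hu : ∀ n : ℕ, N ≤ n → ‖u - hermiteProj μ β n u‖ₑ ^ 2 ≤ ν (Ioi n))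
    (hfin : ∫⁻ x in Ioi (N : ℝ), ENNReal.ofReal (x ^ l) ∂ν ≠ ∞) :
    ∃ G : Lp ℂ 2 (weight μ),
      ‖G‖ₑ ^ 2 ≤ ENNReal.ofReal (derivConst μ l * (β ^ 2) ^ l) *
        (3 ^ l * ∫⁻ x in Ioi (N : ℝ), ENNReal.ofReal (x ^ l) ∂ν) ∧
      ∀ Ω : Set ℝ, IsOpen Ω → (∀ K ⊆ Ω, IsCompact K → weight (-μ) K < ∞) →
        HasWeakDeriv Ω l (u - hermiteProj μ β N u : Lp ℂ 2 (weight μ)) G := by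
  have hceil : ∫⁻ x in Ioi (N : ℝ), (⌈x⌉₊ + 1 : ℝ≥0∞) ^ l ∂ν ≤
      3 ^ l * ∫⁻ x in Ioi (N : ℝ), ENNReal.ofReal (x ^ l) ∂ν := by
    rw [← lintegral_const_mul' _ _ (by simp)]
    refine setLIntegral_mono' measurableSet_Ioi fun x (hx : N < x) => ?_
    have hx1 : 1 < x := lt_of_le_of_lt (by exact_mod_cast hN) hx
    have hx0 : 0 ≤ x := by linarith
    rw [ENNReal.ofReal_pow hx0, ← mul_pow, ← ENNReal.ofReal_natCast, ← ENNReal.ofReal_one,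
      ← ENNReal.ofReal_add (by positivity) zero_le_one, ← ENNReal.ofReal_ofNat,
      ← ENNReal.ofReal_mul (by positivity)]
    gcongr
    linarith [Nat.ceil_lt_add_one hx0]
  have hu0 : hermiteProj μ β 0 (u - hermiteProj μ β N u) = 0 := by
    rw [hermiteProj_sub, hermiteProj_hermiteProj_of_le N.zero_le, sub_self]
  obtain ⟨G, hGnorm, hG⟩ := exists_hasWeakDeriv_of_hermiteProj_zero (l := l)
    (ν := ν.restrict (Ioi (N : ℝ))) hμ hβ hu0 (fun n => by
      rw [sub_hermiteProj_sub_hermiteProj, Measure.restrict_apply measurableSet_Ioi,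
        Ioi_inter_Ioi, ← Nat.cast_max]
      exact hu _ (le_max_right n N))
    (ne_top_of_le_ne_top (ENNReal.mul_ne_top (by simp) hfin) hceil)
  exact ⟨G, hGnorm.trans (by gcongr), hG⟩

end TruncationError

section DecayDensity

theorem le_mul_rpow_one_half_iff {x a b : ℝ≥0∞} :
    x ≤ a * b ^ (1 / 2 : ℝ) ↔ x ^ 2 ≤ a ^ 2 * b := by
  rw [← ENNReal.pow_le_pow_left_iff two_ne_zero, mul_pow, ← ENNReal.rpow_mul_natCast]
  norm_num

theorem setLIntegral_withDensity_restrict {X : Type*} [MeasurableSpace X] {ρ : Measure X}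
    {s t : Set X} {F g : X → ℝ≥0∞} (ht : MeasurableSet t) (hts : t ⊆ s)
    (hF : AEMeasurable F (ρ.restrict s)) (hg : AEMeasurable g (ρ.restrict s)) :
    ∫⁻ x in t, g x ∂(ρ.restrict s).withDensity F = ∫⁻ x in t, F x * g x ∂ρ := by
  rw [restrict_withDensity ht, Measure.restrict_restrict_of_subset hts,
    lintegral_withDensity_eq_lintegral_mul₀ (hF.mono_set hts) (hg.mono_set hts)]
  rfl

end DecayDensity

theorem theorem5p1_general (μ : ℝ) (hμ : -(1 / 2) < μ) (l : ℕ) :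
    ∃ C : ℝ≥0, ∀ (β : ℝ) (ν : Measure ℝ) (u : Lp ℂ 2 (weight μ)) (N : ℕ), 0 < β → 1 ≤ N →
      (∀ n : ℕ, N ≤ n → eLpNorm ⇑(u - hermiteProj μ β n u) 2 (weight μ) ^ 2 ≤ ν (Ioi n)) →
      (∀ g : ℝ → ℂ, HasWeakDeriv {0}ᶜ l ⇑(u - hermiteProj μ β N u) g →
        eLpNorm g 2 (weight μ) ^ 2 ≤
          (C * ENNReal.ofReal (β ^ l)) ^ 2 *
            ∫⁻ x in Ioi (N : ℝ), ENNReal.ofReal (x ^ l) ∂ν) ∧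
      (∫⁻ x in Ioi (N : ℝ), ENNReal.ofReal (x ^ l) ∂ν < ∞ →
        ∃ g : ℝ → ℂ, HasWeakDeriv {0}ᶜ l ⇑(u - hermiteProj μ β N u) g ∧
          (μ < 1 / 2 → HasWeakDeriv univ l ⇑(u - hermiteProj μ β N u) g)) := by
  have hK : 0 < derivConst μ l * 3 ^ l := mul_pos (derivConst_pos hμ l) (by positivity)
  set C : ℝ≥0 := (Real.sqrt (derivConst μ l * 3 ^ l)).toNNReal
  refine ⟨C, fun β ν u N hβ hN hu => ?_⟩
  have hC : (C * ENNReal.ofReal (β ^ l)) ^ 2 =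
      ENNReal.ofReal (derivConst μ l * (β ^ 2) ^ l) * 3 ^ l := by
    rw [← ENNReal.ofReal_ofNat, ← ENNReal.ofReal_pow zero_le_three,
      ← ENNReal.ofReal_mul' (by positivity), ← ENNReal.ofReal,
      ← ENNReal.ofReal_mul (Real.sqrt_nonneg _), ← ENNReal.ofReal_pow (by positivity), mul_pow,
      Real.sq_sqrt hK.le]
    ring_nf
  have hzero (K : Set ℝ) (hK0 : K ⊆ {0}ᶜ) (hK : IsCompact K) : weight (-μ) K < ∞ :=
    weight_lt_top_of_isCompact_of_zero_notMem (-μ) hK fun h => hK0 h rfl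
  have hderiv := exists_hasWeakDeriv_sub_hermiteProj (l := l) hμ (pow_pos hβ 2) hN
    fun n hn => (Lp.enorm_def (u - hermiteProj μ β n u)).symm ▸ hu n hn
  refine ⟨fun g hg => ?_, fun hfin => ?_⟩
  · rcases eq_or_ne (∫⁻ x in Ioi (N : ℝ), ENNReal.ofReal (x ^ l) ∂ν) ∞ with hI | hI
    · have hCβ : (C * ENNReal.ofReal (β ^ l)) ^ 2 ≠ 0 :=
        pow_ne_zero 2 (mul_ne_zero (by simpa [C] using hK)
          (ENNReal.ofReal_pos.2 (pow_pos hβ l)).ne')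
      exact le_top.trans_eq (by rw [hI, ENNReal.mul_top hCβ])
    · obtain ⟨G, hGnorm, hG⟩ := hderiv hI
      rw [eLpNorm_congr_ae (hg.ae_eq_weight (hG _ isOpen_compl_singleton hzero) μ),
        ← Lp.enorm_def, hC, mul_assoc]
      exact hGnorm
  · obtain ⟨G, -, hG⟩ := hderiv hfin.ne
    exact ⟨G, hG _ isOpen_compl_singleton hzero, fun hμ' => hG _ isOpen_univ fun K _ hK =>
      weight_lt_top_of_isCompact (by linarith) hK⟩

end

theorem theorem5p1 (μ : ℝ) (hμ : -(1 / 2) < μ) (l : ℕ) :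
    ∃ C : ℝ≥0, ∀ (β : ℝ) (A : ℝ≥0) (u : Lp ℂ 2 (weight μ)) (f : ℝ → ℂ) (N : ℕ),
      0 < β → 1 ≤ N → AEMeasurable f (volume.restrict (Ioi (N : ℝ))) →
      (∀ n : ℕ, N ≤ n →
        eLpNorm ⇑(u - hermiteProj μ β n u) 2 (weight μ) ≤
          A * (∫⁻ x in Ioi (n : ℝ), ‖f x‖ₑ ^ 2) ^ (1 / 2 : ℝ)) →
      (∀ g : ℝ → ℂ, HasWeakDeriv {0}ᶜ l ⇑(u - hermiteProj μ β N u) g →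
        eLpNorm g 2 (weight μ) ≤
          C * A * ENNReal.ofReal (β ^ l) *
            (∫⁻ x in Ioi (N : ℝ), ‖f x‖ₑ ^ 2 * ENNReal.ofReal (x ^ l)) ^ (1 / 2 : ℝ)) ∧
      ((∫⁻ x in Ioi (N : ℝ), ‖f x‖ₑ ^ 2 * ENNReal.ofReal (x ^ l)) < ∞ →
        ∃ g : ℝ → ℂ, HasWeakDeriv {0}ᶜ l ⇑(u - hermiteProj μ β N u) g ∧
          (μ < 1 / 2 → HasWeakDeriv univ l ⇑(u - hermiteProj μ β N u) g)) := by
  obtain ⟨C, hC⟩ := theorem5p1_general μ hμ l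
  refine ⟨C, fun β A u f N hβ hN hf hu => ?_⟩
  set ν : Measure ℝ :=
    (A : ℝ≥0∞) ^ 2 • (volume.restrict (Ioi (N : ℝ))).withDensity fun x => ‖f x‖ₑ ^ 2
  have hν {n : ℕ} (hn : N ≤ n) {w : ℝ → ℝ≥0∞} (hw : Measurable w) :
      ∫⁻ x in Ioi (n : ℝ), w x ∂ν = (A : ℝ≥0∞) ^ 2 * ∫⁻ x in Ioi (n : ℝ), ‖f x‖ₑ ^ 2 * w x := by
    rw [setLIntegral_smul_measure, setLIntegral_withDensity_restrict measurableSet_Ioi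
      (Ioi_subset_Ioi (by exact_mod_cast hn)) (hf.enorm.pow_const 2) hw.aemeasurable, smul_eq_mul]
  have hdecay (n : ℕ) (hn : N ≤ n) :
      eLpNorm ⇑(u - hermiteProj μ β n u) 2 (weight μ) ^ 2 ≤ ν (Ioi n) := by
    rw [← setLIntegral_one, hν hn measurable_const]
    simpa only [mul_one] using le_mul_rpow_one_half_iff.1 (hu n hn)
  obtain ⟨hbound, hexists⟩ := hC β ν u N hβ hN hdecay
  rw [hν le_rfl (by fun_prop)] at hbound hexists
  refine ⟨fun g hg => le_mul_rpow_one_half_iff.2 ((hbound g hg).trans_eq (by ring)), fun hfin => ?_⟩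
  exact hexists (ENNReal.mul_lt_top (by simp) hfin)
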